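/- Let $\mathcal{A}=\{H_1,\dots,H_m\}$ be a multiarrangement of $m$ linear hyperplanes in $\mathbb{C}^n$ (repetitions allowed), with nonzero normal vectors $\alpha_1,\dots,\alpha_m$. For $S\subseteq\{1,\dots,m\}$ let $\mathrm{rk}(S)$ be the dimension of the span of $\{\alpha_i : i\in S\}$, let $r=\mathrm{rk}(\{1,\dots,m\})$ be the rank of $\mathcal{A}$, and let $\chi_{\mathcal{A}}(z)=\sum_{S\subseteq\{1,\dots,m\}}(-1)^{|S|}z^{\,r-\mathrm{rk}(S)}$ be the characteristic polynomial of (the matroid of) $\mathcal{A}$. For a line $L=\mathbb{C}\cdot(\ell_1,\dots,\ell_n)\subseteq\mathbb{C}^n$ through the origin put $\lambda_L=\ell_1x_1+\cdots+\ell_nx_n$ (defined up to a nonzero scalar) and $\rho_{\mathcal{A}}(L)=\#\{i : L\not\subseteq H_i\}$. For an integer $k\ge 0$ let $$J_{\mathcal{A},k}=\bigl(\lambda_L^{\rho_{\mathcal{A}}(L)+k} : L\subseteq\mathbb{C}^n \text{ a line}\bigr)\subseteq\mathbb{C}[x_1,\dots,x_n],\qquad J'_{\mathcal{A}}=\bigl(\lambda_L^{\max(\rho_{\mathcal{A}}(L),1)}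 : L\subseteq\mathbb{C}^n \text{ a line}\bigr).$$ Let $\Omega_n=\mathbb{C}[x_1,\dots,x_n]\otimes\wedge\{\theta_1,\dots,\theta_n\}$, bigraded by $\deg x_i=(1,0)$ and $\deg\theta_i=(0,1)$, with the operator $df=\sum_{i}(\partial f/\partial x_i)\cdot\theta_i$. Let $I_{\mathcal{A}}\subseteq\Omega_n$ be the smallest two-sided ideal that contains $J_{\mathcal{A},1}$ and is closed under $d$, and let $\mathcal{E}_{\mathcal{A}}=\Omega_n/I_{\mathcal{A}}$, with bigraded Hilbert series $\mathrm{Hilb}(\mathcal{E}_{\mathcal{A}};q,t)=\sum_{i,j\ge 0}\dim_{\mathbb{C}}(\mathcal{E}_{\mathcal{A}})_{i,j}\,q^it^j$. Then $\mathrm{Hilb}(\mathcal{E}_{\mathcal{A}};q,t)$ is a polynomial in $\mathbb{N}[q,t]$, and the following hold. 1. $\mathrm{Hilb}(\mathcal{E}_{\mathcal{A}};q,0)=\mathrm{Hilb}(\mathbb{C}[x_1,\dots,x_n]/J_{\mathcal{A},1};q)$, the Hilbert series of the external zonotopal algebra. 2. If $r=n$, then the coefficient $[t^r]\,\mathrm{Hilb}(\mathcal{E}_{\mathcal{A}};q,t)$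 equals $\mathrm{Hilb}(\mathbb{C}[x_1,\dots,x_n]/J_{\mathcal{A},0};q)$, the Hilbert series of the central zonotopal algebra. For arbitrary $r\le n$, $[t^r]\,\mathrm{Hilb}(\mathcal{E}_{\mathcal{A}};q,t)=\mathrm{Hilb}(\mathbb{C}[x_1,\dots,x_n]/J'_{\mathcal{A}};q)$, where $\mathbb{C}[x_1,\dots,x_n]/J'_{\mathcal{A}}$ is the central zonotopal algebra of the essentialization of $\mathcal{A}$ (and $J'_{\mathcal{A}}=J_{\mathcal{A},0}$ when $r=n$). 3. The summand $\operatorname{top}(\mathcal{A})$ of maximal total degree in $\mathrm{Hilb}(\mathcal{E}_{\mathcal{A}};q,t)$ is $$\operatorname{top}(\mathcal{A})=(-1)^r q^{m-r}t^r\chi_{\mathcal{A}}\!\left(-\frac{q}{t}\right).$$ -/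

import Mathlib

open scoped TensorProduct

noncomputable section

/-- A multiarrangement of `m` linear hyperplanes in `ℂⁿ`, given by a choice of nonzero normal
vectors. Repetitions are allowed. -/
structure Multiarrangement (n m : ℕ) where
  normal : Fin m → Fin n → ℂ
  normal_ne_zero : ∀ i, normal i ≠ 0

namespace Multiarrangement

variable {n m : ℕ} (A : Multiarrangement n m)

/-- The hyperplane `Hᵢ`: the zero set of the linear form `∑ⱼ aⱼ xⱼ`, where `a` is the
`i`-th normal vector. -/
def hyperplane (i : Fin m) : Submodule ℂ (Fin n → ℂ) :=
  LinearMap.ker (∑ j, A.normal i j • (LinearMap.proj j : (Fin n → ℂ) →ₗ[ℂ] ℂ))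

/-- The rank of a subset of the hyperplanes: the dimension of the span of the normal vectors. -/
def rk (S : Finset (Fin m)) : ℕ :=
  Module.finrank ℂ (Submodule.span ℂ (A.normal '' (S : Set (Fin m))))

/-- The rank of the arrangement. -/
def rank : ℕ := A.rk Finset.univ

/-- The characteristic polynomial `∑_{S ⊆ E} (-1)^|S| X^(r - rk S)` of the matroid of the
arrangement. -/
def charPoly : Polynomial ℤ :=
  ∑ S : Finset (Fin m), (-1) ^ S.card * Polynomial.X ^ (A.rank - A.rk S)

/-- `ρ(L)`: the number of hyperplanes, with multiplicity, that do not contain `L`. -/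
def rho (L : Submodule ℂ (Fin n → ℂ)) : ℕ :=
  Set.ncard {i : Fin m | ¬ L ≤ A.hyperplane i}

end Multiarrangement

/-- The linear form `λ = ℓ₁ x₁ + ⋯ + ℓₙ xₙ`. -/
def linearForm {n : ℕ} (l : Fin n → ℂ) : MvPolynomial (Fin n) ℂ :=
  ∑ i, MvPolynomial.C (l i) * MvPolynomial.X i

namespace Multiarrangement

variable {n m : ℕ} (A : Multiarrangement n m)

/-- The power ideal `J_{A,k}`, generated by all `λ_L ^ (ρ(L) + k)` for lines `L = ℂ · ℓ`. -/
def powerIdeal (k : ℕ) : Ideal (MvPolynomial (Fin n) ℂ) :=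
  Ideal.span {f | ∃ l : Fin n → ℂ, l ≠ 0 ∧
    f = linearForm l ^ (A.rho (Submodule.span ℂ {l}) + k)}

/-- The central power ideal of the essentialization of `A`, pulled back to `ℂ[x₁, …, xₙ]`:
generated by `λ_L ^ ρ(L)` for the lines `L` not contained in all hyperplanes, and by `λ_L` for
the lines `L` contained in all of them. -/
def essCentralIdeal : Ideal (MvPolynomial (Fin n) ℂ) :=
  Ideal.span {f | ∃ l : Fin n → ℂ, l ≠ 0 ∧
    f = linearForm l ^ max (A.rho (Submodule.span ℂ {l})) 1}

end Multiarrangement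

/-- Superspace of rank `n`: `ℂ[x₁, …, xₙ] ⊗ ⋀{θ₁, …, θₙ}`. -/
abbrev Superspace (n : ℕ) : Type :=
  MvPolynomial (Fin n) ℂ ⊗[ℂ] ExteriorAlgebra ℂ (Fin n → ℂ)

namespace Superspace

variable {n : ℕ}

/-- The generator `θᵢ` of the exterior algebra. -/
def theta (i : Fin n) : ExteriorAlgebra ℂ (Fin n → ℂ) :=
  ExteriorAlgebra.ι ℂ (Pi.single i 1)

/-- The Euler operator `d f = ∑ᵢ (∂f/∂xᵢ) · θᵢ`. -/
def euler : Superspace n →ₗ[ℂ] Superspace n :=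
  ∑ i, TensorProduct.map (MvPolynomial.pderiv i).toLinearMap (LinearMap.mulRight ℂ (theta i))

/-- The bihomogeneous component of bosonic degree `i` and fermionic degree `j`. -/
def bidegree (n i j : ℕ) : Submodule ℂ (Superspace n) :=
  LinearMap.range (TensorProduct.map (MvPolynomial.homogeneousSubmodule (Fin n) ℂ i).subtype
    (⋀[ℂ]^j (Fin n → ℂ)).subtype)

/-- The differential closure of `J`: the smallest two-sided ideal of superspace that contains
`J` and is closed under `d`. -/
def differentialClosure (J : Ideal (MvPolynomial (Fin n) ℂ)) : Ideal (Superspace n) :=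
  sInf {K | K.IsTwoSided ∧ (∀ f ∈ J, f ⊗ₜ[ℂ] 1 ∈ K) ∧ ∀ w ∈ K, euler w ∈ K}

end Superspace

/-- The dimension of the image of a graded piece `V` of `R` in the quotient `R ⧸ I`. -/
def quotientPieceDim {R : Type*} [Ring R] [Algebra ℂ R] (I : Ideal R) (V : Submodule ℂ R) : ℕ :=
  Module.finrank ℂ (V.map ((Submodule.mkQ I).restrictScalars ℂ))

/-- The Hilbert series `Hilb(ℂ[x₁, …, xₙ] / J; q)` for a homogeneous ideal `J`. -/
def hilb {n : ℕ} (J : Ideal (MvPolynomial (Fin n) ℂ)) : PowerSeries ℕ :=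
  PowerSeries.mk fun i => quotientPieceDim J (MvPolynomial.homogeneousSubmodule (Fin n) ℂ i)

/-- The bigraded Hilbert series `Hilb(Ωₙ / I; q, t)` for a bihomogeneous ideal `I`; the variable
with index `0` is `q` (bosonic degree) and the variable with index `1` is `t` (fermionic
degree). -/
def bigradedHilb {n : ℕ} (I : Ideal (Superspace n)) : MvPowerSeries (Fin 2) ℕ :=
  fun e => quotientPieceDim I (Superspace.bidegree n (e 0) (e 1))

/-- The superspace ideal `I_A`: the differential closure of `J_{A,1}`. -/
def Multiarrangement.superIdeal {n m : ℕ} (A : Multiarrangement n m) : Ideal (Superspace n) :=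
  Superspace.differentialClosure (A.powerIdeal 1)

/-- The bigraded Hilbert series of `E_A = Ωₙ / I_A`. -/
def Multiarrangement.hilbE {n m : ℕ} (A : Multiarrangement n m) : MvPowerSeries (Fin 2) ℕ :=
  bigradedHilb A.superIdeal

/-- `[t^j] F`, the coefficient of `t^j` as a power series in `q`. -/
def tCoeff (j : ℕ) (F : MvPowerSeries (Fin 2) ℕ) : PowerSeries ℕ :=
  PowerSeries.mk fun i => MvPowerSeries.coeff (Finsupp.single 0 i + Finsupp.single 1 j) F

/-- The summand of maximal total degree of a polynomial. -/
def topPart (P : MvPolynomial (Fin 2) ℕ) : MvPolynomial (Fin 2) ℕ :=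
  MvPolynomial.homogeneousComponent P.totalDegree P

/-- The field `ℚ(q, t)` of rational functions, as the fraction field of `ℤ[q, t]`. -/
abbrev RatQT : Type := FractionRing (MvPolynomial (Fin 2) ℤ)

/-- The inclusion of `ℕ[q, t]` into `ℚ(q, t)`. -/
def toRatQT (P : MvPolynomial (Fin 2) ℕ) : RatQT :=
  algebraMap (MvPolynomial (Fin 2) ℤ) RatQT (MvPolynomial.map (Nat.castRingHom ℤ) P)

/-- The variable `q` in `ℚ(q, t)`. -/
def qVar : RatQT := toRatQT (MvPolynomial.X 0)

/-- The variable `t` in `ℚ(q, t)`. -/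
def tVar : RatQT := toRatQT (MvPolynomial.X 1)

end

/-! The proof computes the Macaulay inverse system of `superIdeal`. Write ∂_b and ι_b for `deriv b`
and `contr b`. An element lies in `vanishing [] A.normals` when it is killed by every functional
that applies, for each normal, ∂ or ι or neither, and then takes the constant term. This space is a
two-sided ideal, it is closed under d because ι_b d = ∂_b - d ι_b, and it contains λ^(ρ+1) because a
derivative along a normal lowers the power of λ by at most one, and only if that normal is not
orthogonal to λ. Hence it contains I_A. Conversely I_A contains λ^(ρ+1) and, on applying d, also λ^ρ
dλ; multiples of these span `powerPiece`. The theorem `piece_inf_vanishing_le_powerPiece` closes the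
circle, so the three spaces agree in every bidegree.

That theorem and the Hilbert series both come from deletion-contraction. A second list W records the
normals already contracted: coefficients are constant along W, and members of W act only by ι or not
at all. If b lies in the span of W, it adds no condition. Otherwise ∂_b sends the problem (b :: A,
W) onto the problem (A, W) in one bosonic degree less, with kernel the problem (A, b :: W). The
delicate point is that relations lift along ∂_b; on multiples of powers this is integration by parts
(`exists_deriv_eq_of_mem_powerPiece`). The resulting recursion P(b :: A, W) = q P(A, W) + P(A, b ::
W), with P([], W) = (1 + t)^|W|, defines `hilbPoly`, and `relDim_vanishing` identifies it with the
dimensions.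

The generators in `powerPiece` also give the two extreme coefficients in t. In fermionic degree 0
only λ^(ρ+1) survives. In degree r the quotient has a single form ω over the polynomials modulo I_A,
and the generators λ^ρ dλ amount to λ^ρ ω. The part of top degree m satisfies the same recursion
with zero for b in the span of W; so does the signed subset sum defining χ. -/

open scoped TensorProduct

noncomputable section

/-! ### Derivatives, interior products, parity and d on superspace -/

namespace Superspace

open MvPolynomial

variable {n : ℕ}

/-- The directional derivative `∑ᵢ wᵢ ∂/∂xᵢ`. -/
def polyDeriv (w : Fin n → ℂ) : Derivation ℂ (MvPolynomial (Fin n) ℂ) (MvPolynomial (Fin n) ℂ) :=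
  ∑ i, w i • pderiv i

/-- The linear functional on `ℂⁿ` given by the dot product with `w`. -/
def dotDual (w : Fin n → ℂ) : Module.Dual ℂ (Fin n → ℂ) := dotProductBilin ℂ ℂ w

@[simp] lemma dotDual_apply (w v : Fin n → ℂ) : dotDual w v = w ⬝ᵥ v := rfl

/-- The interior product of the exterior algebra with a covector, acting from the right. -/
def extContr (w : Fin n → ℂ) :
    ExteriorAlgebra ℂ (Fin n → ℂ) →ₗ[ℂ] ExteriorAlgebra ℂ (Fin n → ℂ) :=
  CliffordAlgebra.contractRight.flip (dotDual w)

/-- The directional derivative on superspace. -/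
def deriv (w : Fin n → ℂ) : Superspace n →ₗ[ℂ] Superspace n :=
  LinearMap.rTensor _ (polyDeriv w : MvPolynomial (Fin n) ℂ →ₗ[ℂ] MvPolynomial (Fin n) ℂ)

/-- The interior product on superspace. -/
def contr (w : Fin n → ℂ) : Superspace n →ₗ[ℂ] Superspace n :=
  LinearMap.lTensor _ (extContr w)

/-- The one-form `dλ = ∑ᵢ vᵢ θᵢ`. -/
def form (v : Fin n → ℂ) : Superspace n := 1 ⊗ₜ ExteriorAlgebra.ι ℂ v

/-- The linear form `λ = ∑ᵢ vᵢ xᵢ` in superspace. -/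
def lin (v : Fin n → ℂ) : Superspace n := linearForm v ⊗ₜ 1

lemma form_add (v w : Fin n → ℂ) : form (v + w) = form v + form w := by
  simp [form, TensorProduct.tmul_add]

lemma form_smul (c : ℂ) (v : Fin n → ℂ) : form (c • v) = c • form v := by
  simp [form]

lemma lin_pow (v : Fin n → ℂ) (k : ℕ) : lin v ^ k = (linearForm v ^ k) ⊗ₜ 1 := by
  simp [lin, Algebra.TensorProduct.tmul_pow]

lemma polyDeriv_apply (w : Fin n → ℂ) (p : MvPolynomial (Fin n) ℂ) :
    polyDeriv w p = ∑ i, w i • pderiv i p := by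
  have h : ⇑(polyDeriv w) = ∑ i, ⇑(w i • pderiv (R := ℂ) i) :=
    map_sum (Derivation.coeFnAddMonoidHom (R := ℂ) (A := MvPolynomial (Fin n) ℂ)
      (M := MvPolynomial (Fin n) ℂ)) (fun i => w i • pderiv i) Finset.univ
  rw [h, Finset.sum_apply]
  rfl

lemma polyDeriv_linearForm (w v : Fin n → ℂ) : polyDeriv w (linearForm v) = C (w ⬝ᵥ v) := by
  simp [polyDeriv_apply, linearForm, dotProduct, Pi.single_apply, MvPolynomial.smul_eq_C_mul, mul_comm]

lemma polyDeriv_comm (w v : Fin n → ℂ) (p : MvPolynomial (Fin n) ℂ) :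
    polyDeriv w (polyDeriv v p) = polyDeriv v (polyDeriv w p) := by
  have : ⁅polyDeriv w, polyDeriv v⁆ = 0 := by
    apply MvPolynomial.derivation_ext
    intro i
    simp [Derivation.commutator_apply, polyDeriv_apply, Pi.single_apply]
  have h := congrArg (fun L => L p) this
  simpa [Derivation.commutator_apply, sub_eq_zero] using h

@[simp] lemma deriv_tmul (w : Fin n → ℂ) (p : MvPolynomial (Fin n) ℂ)
    (ω : ExteriorAlgebra ℂ (Fin n → ℂ)) : deriv w (p ⊗ₜ ω) = polyDeriv w p ⊗ₜ ω := rfl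

@[simp] lemma contr_tmul (w : Fin n → ℂ) (p : MvPolynomial (Fin n) ℂ)
    (ω : ExteriorAlgebra ℂ (Fin n → ℂ)) : contr w (p ⊗ₜ ω) = p ⊗ₜ extContr w ω := rfl

lemma extContr_mul_ι (w v : Fin n → ℂ) (ω : ExteriorAlgebra ℂ (Fin n → ℂ)) :
    extContr w (ω * ExteriorAlgebra.ι ℂ v) =
      (w ⬝ᵥ v) • ω - extContr w ω * ExteriorAlgebra.ι ℂ v :=
  CliffordAlgebra.contractRight_mul_ι _ _ _

@[simp] lemma extContr_algebraMap (w : Fin n → ℂ) (c : ℂ) :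
    extContr w (algebraMap ℂ _ c) = 0 :=
  CliffordAlgebra.contractRight_algebraMap _ _ _

@[simp] lemma extContr_one (w : Fin n → ℂ) :
    extContr w 1 = 0 :=
  CliffordAlgebra.contractRight_one _ _

lemma deriv_mul (w : Fin n → ℂ) (a b : Superspace n) :
    deriv w (a * b) = deriv w a * b + a * deriv w b := by
  induction a using TensorProduct.induction_on with
  | zero => simp
  | add x y hx hy => simp only [add_mul, map_add, hx, hy]; abel
  | tmul p ω =>
    induction b using TensorProduct.induction_on with
    | zero => simp
    | add x y hx hy => simp only [mul_add, map_add, hx, hy]; abel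
    | tmul q η =>
      simp only [Algebra.TensorProduct.tmul_mul_tmul, deriv_tmul, Derivation.leibniz, smul_eq_mul,
        ← TensorProduct.add_tmul]
      congr 1; ring

lemma contr_mul_form (w v : Fin n → ℂ) (a : Superspace n) :
    contr w (a * form v) = (w ⬝ᵥ v) • a - contr w a * form v := by
  induction a using TensorProduct.induction_on with
  | zero => simp
  | add x y hx hy => simp only [add_mul, map_add, hx, hy, smul_add]; abel
  | tmul p ω =>
    simp [form, extContr_mul_ι, TensorProduct.tmul_sub]

lemma contr_poly_mul (w : Fin n → ℂ) (p : MvPolynomial (Fin n) ℂ) (a : Superspace n) :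
    contr w (p ⊗ₜ 1 * a) = p ⊗ₜ 1 * contr w a := by
  induction a using TensorProduct.induction_on with
  | zero => simp
  | add x y hx hy => simp only [mul_add, map_add, hx, hy]
  | tmul q ω => simp

lemma poly_mul_comm (p : MvPolynomial (Fin n) ℂ) (a : Superspace n) :
    p ⊗ₜ 1 * a = a * p ⊗ₜ 1 := by
  induction a using TensorProduct.induction_on with
  | zero => simp
  | add x y hx hy => simp only [mul_add, add_mul, hx, hy]
  | tmul q ω => simp [mul_comm]

lemma contr_mul_poly (w : Fin n → ℂ) (p : MvPolynomial (Fin n) ℂ) (a : Superspace n) :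
    contr w (a * p ⊗ₜ 1) = contr w a * p ⊗ₜ 1 := by
  rw [← poly_mul_comm, contr_poly_mul, poly_mul_comm]

lemma lin_pow_comm (v : Fin n → ℂ) (k : ℕ) (a : Superspace n) :
    lin v ^ k * a = a * lin v ^ k := by
  rw [lin_pow, poly_mul_comm]

lemma deriv_comm (w v : Fin n → ℂ) (a : Superspace n) :
    deriv w (deriv v a) = deriv v (deriv w a) := by
  induction a using TensorProduct.induction_on with
  | zero => simp
  | add x y hx hy => simp only [map_add, hx, hy]
  | tmul q ω => simp [polyDeriv_comm w v]

lemma contr_deriv (w v : Fin n → ℂ) (a : Superspace n) :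
    contr w (deriv v a) = deriv v (contr w a) := by
  induction a using TensorProduct.induction_on with
  | zero => simp
  | add x y hx hy => simp only [map_add, hx, hy]
  | tmul q ω => simp

lemma contr_contr (w v : Fin n → ℂ) (a : Superspace n) :
    contr w (contr v a) = - contr v (contr w a) := by
  induction a using TensorProduct.induction_on with
  | zero => simp
  | add x y hx hy => simp only [map_add, hx, hy]; abel
  | tmul q ω =>
    simp only [contr_tmul, ← TensorProduct.tmul_neg]
    congr 1
    exact CliffordAlgebra.contractRight_comm (dotDual v) (dotDual w) ω

lemma contr_self (w : Fin n → ℂ) (a : Superspace n) : contr w (contr w a) = 0 := by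
  induction a using TensorProduct.induction_on with
  | zero => simp
  | add x y hx hy => simp only [map_add, hx, hy]; simp
  | tmul q ω =>
    simp only [contr_tmul]
    have : extContr w (extContr w ω) = 0 := CliffordAlgebra.contractRight_contractRight _ _
    simp [this]

lemma deriv_add_left (w v : Fin n → ℂ) (a : Superspace n) :
    deriv (w + v) a = deriv w a + deriv v a := by
  induction a using TensorProduct.induction_on with
  | zero => simp
  | add x y hx hy => simp only [map_add, hx, hy]; abel
  | tmul q ω =>
    simp [polyDeriv_apply, add_smul, Finset.sum_add_distrib, TensorProduct.add_tmul]

lemma deriv_smul_left (c : ℂ) (w : Fin n → ℂ) (a : Superspace n) :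
    deriv (c • w) a = c • deriv w a := by
  induction a using TensorProduct.induction_on with
  | zero => simp
  | add x y hx hy => simp only [map_add, hx, hy, smul_add]
  | tmul q ω =>
    simp [polyDeriv_apply, mul_smul, ← Finset.smul_sum, TensorProduct.smul_tmul']

lemma contr_add_left (w v : Fin n → ℂ) (a : Superspace n) :
    contr (w + v) a = contr w a + contr v a := by
  induction a using TensorProduct.induction_on with
  | zero => simp
  | add x y hx hy => simp only [map_add, hx, hy]; abel
  | tmul q ω =>
    simp [extContr, dotDual, TensorProduct.tmul_add]

lemma contr_smul_left (c : ℂ) (w : Fin n → ℂ) (a : Superspace n) :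
    contr (c • w) a = c • contr w a := by
  induction a using TensorProduct.induction_on with
  | zero => simp
  | add x y hx hy => simp only [map_add, hx, hy, smul_add]
  | tmul q ω =>
    simp [extContr, dotDual]

@[simp] lemma deriv_one (w : Fin n → ℂ) : deriv w (1 : Superspace n) = 0 := by
  rw [Algebra.TensorProduct.one_def, deriv_tmul]; simp

@[simp] lemma contr_one (w : Fin n → ℂ) : contr w (1 : Superspace n) = 0 := by
  rw [Algebra.TensorProduct.one_def, contr_tmul]; simp

@[simp] lemma deriv_form (w v : Fin n → ℂ) : deriv w (form v) = 0 := by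
  simp [form]

lemma contr_form (w v : Fin n → ℂ) : contr w (form v) = (w ⬝ᵥ v) • 1 := by
  simpa using contr_mul_form w v 1

lemma deriv_lin (w v : Fin n → ℂ) : deriv w (lin v) = (w ⬝ᵥ v) • 1 := by
  rw [lin, deriv_tmul, polyDeriv_linearForm, Algebra.TensorProduct.one_def,
    TensorProduct.smul_tmul', MvPolynomial.smul_eq_C_mul, mul_one]

lemma contr_lin_pow (w v : Fin n → ℂ) (k : ℕ) : contr w (lin v ^ k) = 0 := by
  simp [lin_pow]

lemma deriv_lin_pow (w v : Fin n → ℂ) (k : ℕ) :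
    deriv w (lin v ^ (k + 1)) = ((k + 1 : ℂ) * (w ⬝ᵥ v)) • lin v ^ k := by
  induction k with
  | zero => simp [deriv_lin]
  | succ k ih =>
    rw [pow_succ, deriv_mul, ih, deriv_lin, smul_mul_assoc, ← pow_succ, mul_smul_comm, mul_one,
      ← add_smul]
    push_cast; ring_nf

lemma deriv_lin_pow_eq_zero {w v : Fin n → ℂ} (h : w ⬝ᵥ v = 0) (k : ℕ) :
    deriv w (lin v ^ k) = 0 := by
  cases k with
  | zero => simp
  | succ k => simp [deriv_lin_pow, h]

/-- The parity involution of superspace. -/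
def parity : Superspace n →ₐ[ℂ] Superspace n :=
  Algebra.TensorProduct.map (AlgHom.id ℂ _) CliffordAlgebra.involute

@[simp] lemma parity_tmul (p : MvPolynomial (Fin n) ℂ) (ω : ExteriorAlgebra ℂ (Fin n → ℂ)) :
    parity (p ⊗ₜ ω) = p ⊗ₜ CliffordAlgebra.involute ω := rfl

lemma parity_deriv (w : Fin n → ℂ) (a : Superspace n) :
    parity (deriv w a) = deriv w (parity a) := by
  induction a using TensorProduct.induction_on with
  | zero => simp
  | add x y hx hy => simp only [map_add, hx, hy]
  | tmul q ω => simp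

lemma involute_extContr (w : Fin n → ℂ) (ω : ExteriorAlgebra ℂ (Fin n → ℂ)) :
    CliffordAlgebra.involute (extContr w ω) = - extContr w (CliffordAlgebra.involute ω) := by
  induction ω using CliffordAlgebra.right_induction with
  | algebraMap r =>
    have := extContr_algebraMap w r
    rw [AlgHom.commutes]
    change CliffordAlgebra.involute (extContr w (algebraMap ℂ (ExteriorAlgebra ℂ _) r)) =
      - extContr w (algebraMap ℂ (ExteriorAlgebra ℂ _) r)
    simp [this]
  | add x y hx hy => simp only [map_add, hx, hy, neg_add]
  | mul_ι m x hx =>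
    have h1 := extContr_mul_ι w m x
    have h2 := extContr_mul_ι w m (CliffordAlgebra.involute x)
    rw [h1, map_mul, CliffordAlgebra.involute_ι, mul_neg, map_neg, h2, map_sub, map_mul,
      CliffordAlgebra.involute_ι, hx, map_smul]
    simp

lemma parity_contr (w : Fin n → ℂ) (a : Superspace n) :
    parity (contr w a) = - contr w (parity a) := by
  induction a using TensorProduct.induction_on with
  | zero => simp
  | add x y hx hy => simp only [map_add, hx, hy, neg_add]
  | tmul q ω => simp [involute_extContr, TensorProduct.tmul_neg]

lemma ι_mul_eq (v : Fin n → ℂ) (ω : ExteriorAlgebra ℂ (Fin n → ℂ)) :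
    ExteriorAlgebra.ι ℂ v * ω = CliffordAlgebra.involute ω * ExteriorAlgebra.ι ℂ v := by
  induction ω using CliffordAlgebra.right_induction with
  | algebraMap r =>
    rw [AlgHom.commutes]; exact (Algebra.commutes r (ExteriorAlgebra.ι ℂ v)).symm
  | add x y hx hy => simp only [map_add, mul_add, add_mul, hx, hy]
  | mul_ι m x hx =>
    have h : ExteriorAlgebra.ι ℂ v * ExteriorAlgebra.ι ℂ m =
        - (ExteriorAlgebra.ι ℂ m * ExteriorAlgebra.ι ℂ v) :=
      eq_neg_of_add_eq_zero_left (ExteriorAlgebra.ι_add_mul_swap v m)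
    rw [← mul_assoc, hx, mul_assoc, h, map_mul, CliffordAlgebra.involute_ι]
    simp [mul_assoc]

/-- Reduces left multiplication by a one-form to right multiplication, for which contraction has the
simple product rule `contr_mul_form`. -/
lemma form_mul_eq (v : Fin n → ℂ) (a : Superspace n) :
    form v * a = parity a * form v := by
  induction a using TensorProduct.induction_on with
  | zero => simp
  | add x y hx hy => simp only [map_add, mul_add, add_mul, hx, hy]
  | tmul q ω => simp [form, ι_mul_eq]

lemma form_mul_self (v : Fin n → ℂ) : form v * form v = 0 := by
  simp [form]

lemma form_mul_swap (v w : Fin n → ℂ) :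
    form v * form w = (-1 : ℂ) • (form w * form v) := by
  simp only [form, Algebra.TensorProduct.tmul_mul_tmul, ← TensorProduct.tmul_smul]
  congr 1
  rw [neg_one_smul]
  exact eq_neg_of_add_eq_zero_left (ExteriorAlgebra.ι_add_mul_swap v w)

/-- The augmentation of superspace: the constant coefficient. -/
def augmentation (n : ℕ) : Superspace n →ₐ[ℂ] ℂ :=
  Algebra.TensorProduct.lift (MvPolynomial.aeval 0) ExteriorAlgebra.algebraMapInv
    (fun _ _ => Commute.all _ _)

@[simp] lemma augmentation_tmul (p : MvPolynomial (Fin n) ℂ)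
    (ω : ExteriorAlgebra ℂ (Fin n → ℂ)) :
    augmentation n (p ⊗ₜ ω) = MvPolynomial.aeval 0 p * ExteriorAlgebra.algebraMapInv ω := rfl

@[simp] lemma augmentation_form (v : Fin n → ℂ) : augmentation n (form v) = 0 := by
  simp [form, ExteriorAlgebra.algebraMapInv]

@[simp] lemma augmentation_lin (v : Fin n → ℂ) : augmentation n (lin v) = 0 := by
  simp [lin, linearForm]

lemma augmentation_parity (a : Superspace n) :
    augmentation n (parity a) = augmentation n a := by
  have : (augmentation n).comp parity = augmentation n := by
    ext i
    · simp
    · simp [ExteriorAlgebra.algebraMapInv]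
  exact congrArg (fun L => L a) this

lemma euler_apply (a : Superspace n) :
    euler a = ∑ i, deriv (Pi.single i 1) a * form (Pi.single i 1) := by
  simp only [euler, LinearMap.sum_apply]
  refine Finset.sum_congr rfl fun i _ => ?_
  induction a using TensorProduct.induction_on with
  | zero => simp
  | add x y hx hy => simp only [map_add, add_mul, hx, hy]
  | tmul q ω => simp [form, theta, polyDeriv_apply, Pi.single_apply]

lemma deriv_eq_sum (w : Fin n → ℂ) (a : Superspace n) :
    deriv w a = ∑ i, w i • deriv (Pi.single i 1) a := by
  induction a using TensorProduct.induction_on with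
  | zero => simp
  | add x y hx hy => simp only [map_add, hx, hy, smul_add, Finset.sum_add_distrib]
  | tmul q ω =>
    simp [polyDeriv_apply, Pi.single_apply, TensorProduct.sum_tmul, TensorProduct.smul_tmul']

lemma deriv_euler (w : Fin n → ℂ) (a : Superspace n) :
    deriv w (euler a) = euler (deriv w a) := by
  simp [euler_apply, deriv_mul, deriv_comm w]

/-- Cartan's formula, with the Lie derivative along a constant field being `deriv w`. -/
lemma contr_euler (w : Fin n → ℂ) (a : Superspace n) :
    contr w (euler a) = deriv w a - euler (contr w a) := by
  simp [euler_apply, contr_mul_form, contr_deriv, Finset.sum_sub_distrib, deriv_eq_sum w a]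

/-! ### The bigrading -/

lemma exteriorPower_zero_eq : ⋀[ℂ]^0 (Fin n → ℂ) = 1 := pow_zero _

lemma exteriorPower_succ_eq (j : ℕ) : ⋀[ℂ]^(j + 1) (Fin n → ℂ) =
    ⋀[ℂ]^j (Fin n → ℂ) * LinearMap.range (ExteriorAlgebra.ι ℂ) := pow_succ _ _

lemma bidegree_eq_span (i j : ℕ) : bidegree n i j =
    Submodule.span ℂ {a | ∃ p : MvPolynomial (Fin n) ℂ, ∃ ω : ExteriorAlgebra ℂ (Fin n → ℂ),
      p.IsHomogeneous i ∧ ω ∈ ⋀[ℂ]^j (Fin n → ℂ) ∧ a = p ⊗ₜ ω} := by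
  rw [bidegree, TensorProduct.range_map_eq_span_tmul]
  congr 1
  ext a
  constructor
  · rintro ⟨p, ω, rfl⟩
    exact ⟨p, ω, p.2, ω.2, rfl⟩
  · rintro ⟨p, ω, hp, hω, rfl⟩
    exact ⟨⟨p, hp⟩, ⟨ω, hω⟩, rfl⟩

lemma tmul_mem_bidegree {i j : ℕ} {p : MvPolynomial (Fin n) ℂ}
    {ω : ExteriorAlgebra ℂ (Fin n → ℂ)} (hp : p.IsHomogeneous i)
    (hω : ω ∈ ⋀[ℂ]^j (Fin n → ℂ)) : p ⊗ₜ ω ∈ bidegree n i j := by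
  rw [bidegree_eq_span]
  exact Submodule.subset_span ⟨p, ω, hp, hω, rfl⟩

/-- To check that a linear map sends `bidegree n i j` into a submodule, it suffices to check it on
pure tensors. -/
lemma map_mem_of_tmul {E : Type*} [AddCommGroup E] [Module ℂ E] (T : Superspace n →ₗ[ℂ] E)
    (K : Submodule ℂ E) {i j : ℕ}
    (h : ∀ (p : MvPolynomial (Fin n) ℂ) (ω : ExteriorAlgebra ℂ (Fin n → ℂ)),
      p.IsHomogeneous i → ω ∈ ⋀[ℂ]^j (Fin n → ℂ) → T (p ⊗ₜ ω) ∈ K)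
    {a : Superspace n} (ha : a ∈ bidegree n i j) : T a ∈ K := by
  have : bidegree n i j ≤ K.comap T := by
    rw [bidegree_eq_span, Submodule.span_le]
    rintro _ ⟨p, ω, hp, hω, rfl⟩
    exact h p ω hp hω
  exact this ha

lemma isHomogeneous_linearForm (v : Fin n → ℂ) : (linearForm v).IsHomogeneous 1 :=
  IsHomogeneous.sum _ _ _ fun i _ => by
    simpa using (isHomogeneous_C (Fin n) (v i)).mul (isHomogeneous_X ℂ i)

lemma mul_poly_mem_bidegree {i j k : ℕ} {q : MvPolynomial (Fin n) ℂ} (hq : q.IsHomogeneous k)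
    {a : Superspace n} (ha : a ∈ bidegree n i j) : a * q ⊗ₜ 1 ∈ bidegree n (i + k) j :=
  map_mem_of_tmul (LinearMap.mulRight ℂ (q ⊗ₜ 1)) _ (fun p ω hp hω => by
    simpa using tmul_mem_bidegree (hp.mul hq) hω) ha

lemma mul_lin_pow_mem_bidegree {i j : ℕ} (v : Fin n → ℂ) (k : ℕ)
    {a : Superspace n} (ha : a ∈ bidegree n i j) : a * lin v ^ k ∈ bidegree n (i + k) j := by
  rw [lin_pow]
  exact mul_poly_mem_bidegree (by simpa using (isHomogeneous_linearForm v).pow k) ha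

lemma mul_form_mem_bidegree {i j : ℕ} (v : Fin n → ℂ)
    {a : Superspace n} (ha : a ∈ bidegree n i j) : a * form v ∈ bidegree n i (j + 1) :=
  map_mem_of_tmul (LinearMap.mulRight ℂ (form v)) _ (fun p ω hp hω => by
    rw [LinearMap.mulRight_apply, form, Algebra.TensorProduct.tmul_mul_tmul, mul_one]
    refine tmul_mem_bidegree hp ?_
    rw [exteriorPower_succ_eq]
    exact Submodule.mul_mem_mul hω ⟨v, rfl⟩) ha

lemma isHomogeneous_polyDeriv (w : Fin n → ℂ) {p : MvPolynomial (Fin n) ℂ} {i : ℕ}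
    (hp : p.IsHomogeneous (i + 1)) : (polyDeriv w p).IsHomogeneous i := by
  rw [polyDeriv_apply]
  refine IsHomogeneous.sum _ _ _ fun k _ => ?_
  exact (homogeneousSubmodule (Fin n) ℂ i).smul_mem _ hp.pderiv

lemma deriv_mem_bidegree {i j : ℕ} (w : Fin n → ℂ)
    {a : Superspace n} (ha : a ∈ bidegree n (i + 1) j) : deriv w a ∈ bidegree n i j :=
  map_mem_of_tmul (deriv w) _ (fun _ _ hp hω =>
    tmul_mem_bidegree (isHomogeneous_polyDeriv w hp) hω) ha

lemma deriv_eq_zero {j : ℕ} (w : Fin n → ℂ)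
    {a : Superspace n} (ha : a ∈ bidegree n 0 j) : deriv w a = 0 :=
  map_mem_of_tmul (deriv w) ⊥ (fun p ω hp _ => by
    obtain ⟨c, rfl⟩ : ∃ c, p = C c := ⟨_, (totalDegree_eq_zero_iff_eq_C).1 (by
      simpa using hp.totalDegree_le)⟩
    simp) ha

lemma extContr_mem (w : Fin n → ℂ) (j : ℕ) : ∀ {ω : ExteriorAlgebra ℂ (Fin n → ℂ)},
    ω ∈ ⋀[ℂ]^(j + 1) (Fin n → ℂ) → extContr w ω ∈ ⋀[ℂ]^j (Fin n → ℂ) := by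
  induction j with
  | zero =>
    intro ω hω
    rw [exteriorPower_succ_eq, exteriorPower_zero_eq, one_mul] at hω
    obtain ⟨v, rfl⟩ := hω
    have := extContr_mul_ι w v 1
    simp only [one_mul, extContr_one, zero_mul, sub_zero] at this
    rw [this, exteriorPower_zero_eq]
    exact Submodule.smul_mem _ _ (Submodule.one_le.1 le_rfl)
  | succ j ih =>
    intro ω hω
    rw [exteriorPower_succ_eq] at hω
    refine Submodule.mul_induction_on hω ?_ fun x y hx hy => by
      rw [map_add]; exact add_mem hx hy
    rintro η hη _ ⟨v, rfl⟩
    rw [extContr_mul_ι]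
    refine sub_mem (Submodule.smul_mem _ _ hη) ?_
    rw [exteriorPower_succ_eq]
    exact Submodule.mul_mem_mul (ih hη) ⟨v, rfl⟩

lemma contr_mem_bidegree {i j : ℕ} (w : Fin n → ℂ)
    {a : Superspace n} (ha : a ∈ bidegree n i (j + 1)) : contr w a ∈ bidegree n i j :=
  map_mem_of_tmul (contr w) _ (fun _ _ hp hω =>
    tmul_mem_bidegree hp (extContr_mem w j hω)) ha

lemma exists_algebraMap {ω : ExteriorAlgebra ℂ (Fin n → ℂ)} (hω : ω ∈ ⋀[ℂ]^0 (Fin n → ℂ)) :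
    ∃ c : ℂ, ω = algebraMap ℂ _ c := by
  rw [exteriorPower_zero_eq, Submodule.mem_one] at hω
  exact hω.imp fun _ h => h.symm

lemma contr_eq_zero {i : ℕ} (w : Fin n → ℂ)
    {a : Superspace n} (ha : a ∈ bidegree n i 0) : contr w a = 0 :=
  map_mem_of_tmul (contr w) ⊥ (fun p ω _ hω => by
    obtain ⟨c, rfl⟩ := exists_algebraMap hω
    simp) ha

lemma augmentation_eq_zero_of_pos_left {i j : ℕ}
    {a : Superspace n} (ha : a ∈ bidegree n (i + 1) j) : augmentation n a = 0 :=
  map_mem_of_tmul (augmentation n).toLinearMap ⊥ (fun p ω hp _ => by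
    have : MvPolynomial.aeval (0 : Fin n → ℂ) p = 0 := by
      rw [MvPolynomial.aeval_zero]
      simp [constantCoeff_eq, hp.coeff_eq_zero (d := 0) (by simp)]
    simp [this]) ha

lemma augmentation_eq_zero_of_pos_right {i j : ℕ}
    {a : Superspace n} (ha : a ∈ bidegree n i (j + 1)) : augmentation n a = 0 :=
  map_mem_of_tmul (augmentation n).toLinearMap ⊥ (fun p ω _ hω => by
    have : ExteriorAlgebra.algebraMapInv ω = 0 := by
      rw [exteriorPower_succ_eq] at hω
      refine Submodule.mul_induction_on hω ?_ fun x y hx hy => by simp [hx, hy]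
      rintro η _ _ ⟨v, rfl⟩
      simp [ExteriorAlgebra.algebraMapInv]
    simp [this]) ha

lemma bidegree_succ_le_span (i j : ℕ) : bidegree n i (j + 1) ≤
    Submodule.span ℂ {a | ∃ b ∈ bidegree n i j, ∃ v, a = b * form v} := by
  intro a ha
  refine map_mem_of_tmul LinearMap.id _ (fun p ω hp hω => ?_) ha
  rw [exteriorPower_succ_eq] at hω
  refine Submodule.mul_induction_on hω ?_ fun x y hx hy => by
    simp only [LinearMap.id_apply, TensorProduct.tmul_add] at *; exact add_mem hx hy
  rintro η hη _ ⟨v, rfl⟩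
  refine Submodule.subset_span ⟨p ⊗ₜ η, tmul_mem_bidegree hp hη, v, ?_⟩
  simp [form]

lemma euler_identity {i j : ℕ} {a : Superspace n} (ha : a ∈ bidegree n i j) :
    ∑ k, deriv (Pi.single k 1) a * lin (Pi.single k 1) = (i : ℂ) • a := by
  have := map_mem_of_tmul (∑ k : Fin n, LinearMap.mulRight ℂ (lin (Pi.single k 1)) ∘ₗ
    deriv (Pi.single k 1) - (i : ℂ) • LinearMap.id) ⊥ (fun p ω hp hω => by
      have h := hp.sum_X_mul_pderiv
      simp only [lin, linearForm, LinearMap.sub_apply, LinearMap.sum_apply, LinearMap.comp_apply,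
        deriv_tmul, LinearMap.mulRight_apply, Algebra.TensorProduct.tmul_mul_tmul, mul_one,
        ← TensorProduct.sum_tmul, polyDeriv_apply, Pi.single_apply, LinearMap.smul_apply,
        LinearMap.id_apply, TensorProduct.smul_tmul', Submodule.mem_bot]
      rw [← TensorProduct.sub_tmul]
      refine (congrArg (· ⊗ₜ[ℂ] ω) (sub_eq_zero.2 ?_)).trans (TensorProduct.zero_tmul _ ω)
      simpa [mul_comm, Algebra.smul_def] using h) ha
  simpa [sub_eq_zero] using this

instance (i j : ℕ) : FiniteDimensional ℂ (bidegree n i j) := by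
  have : FiniteDimensional ℂ (homogeneousSubmodule (Fin n) ℂ i) := by
    exact Module.Finite.iff_fg.2 (homogeneousSubmodule_fg _ _ i)
  unfold bidegree
  infer_instance

/-! ### Ideals defined by vanishing functionals -/

/-- The elements of superspace annihilated by all products of interior products with members
of `W`, followed by the augmentation. -/
def vanishingBase : List (Fin n → ℂ) → Submodule ℂ (Superspace n)
  | [] => LinearMap.ker (augmentation n).toLinearMap
  | w :: W => vanishingBase W ⊓ (vanishingBase W).comap (contr w)

/-- The elements of superspace annihilated by all functionals of the form: apply interior products
with members of `W`, apply for each member of `A` either the derivative or the interior product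
along it or nothing, and take the augmentation. -/
def vanishing (W : List (Fin n → ℂ)) : List (Fin n → ℂ) → Submodule ℂ (Superspace n)
  | [] => vanishingBase W
  | b :: A => vanishing W A ⊓ (vanishing W A).comap (deriv b) ⊓ (vanishing W A).comap (contr b)

lemma mem_vanishingBase_nil {a : Superspace n} :
    a ∈ vanishingBase [] ↔ augmentation n a = 0 := Iff.rfl

lemma mem_vanishing_nil {W : List (Fin n → ℂ)} {a : Superspace n} :
    a ∈ vanishing W [] ↔ a ∈ vanishingBase W := Iff.rfl

lemma mem_vanishingBase_cons {w : Fin n → ℂ} {W : List (Fin n → ℂ)} {a : Superspace n} :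
    a ∈ vanishingBase (w :: W) ↔ a ∈ vanishingBase W ∧ contr w a ∈ vanishingBase W := Iff.rfl

lemma mem_vanishing_cons {b : Fin n → ℂ} {W A : List (Fin n → ℂ)} {a : Superspace n} :
    a ∈ vanishing W (b :: A) ↔
      a ∈ vanishing W A ∧ deriv b a ∈ vanishing W A ∧ contr b a ∈ vanishing W A := by
  simp [vanishing, and_assoc]

/-- The order of the operators is immaterial, since they commute up to sign; so a contraction from W
may be applied before those from A. -/
lemma mem_vanishing_cons_left {w : Fin n → ℂ} {W A : List (Fin n → ℂ)} {a : Superspace n} :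
    a ∈ vanishing (w :: W) A ↔ a ∈ vanishing W A ∧ contr w a ∈ vanishing W A := by
  induction A generalizing a with
  | nil => exact Iff.rfl
  | cons b A ih =>
    simp only [mem_vanishing_cons, ih, contr_deriv, contr_contr w b, neg_mem_iff]
    tauto

lemma contr_mem_vanishing_of_mem {w : Fin n → ℂ} {W : List (Fin n → ℂ)} (A : List (Fin n → ℂ))
    (hw : w ∈ W) {a : Superspace n} (ha : a ∈ vanishing W A) : contr w a ∈ vanishing W A := by
  induction W generalizing a with
  | nil => simp at hw
  | cons v W ih =>
    rw [mem_vanishing_cons_left] at ha ⊢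
    rcases List.mem_cons.1 hw with rfl | hw
    · exact ⟨ha.2, by rw [contr_self]; exact zero_mem _⟩
    · refine ⟨ih hw ha.1, ?_⟩
      rw [contr_contr, neg_mem_iff]
      exact ih hw ha.2

/-- A further contraction along W either is already among the permitted functionals or repeats one
and gives zero, as contractions square to zero. This is why a normal in the span of W adds no
condition. -/
lemma contr_mem_vanishing {w : Fin n → ℂ} {W : List (Fin n → ℂ)} (A : List (Fin n → ℂ))
    (hw : w ∈ Submodule.span ℂ {x | x ∈ W}) {a : Superspace n} (ha : a ∈ vanishing W A) :
    contr w a ∈ vanishing W A := by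
  induction hw using Submodule.span_induction with
  | mem x hx => exact contr_mem_vanishing_of_mem A hx ha
  | zero =>
    rw [← zero_smul ℂ (0 : Fin n → ℂ), contr_smul_left, zero_smul]
    exact zero_mem _
  | add x y _ _ hx hy => rw [contr_add_left]; exact add_mem hx hy
  | smul c x _ hx => rw [contr_smul_left]; exact Submodule.smul_mem _ _ hx

/-- An induction principle for `vanishing W A`: a property of submodules that holds for the
augmentation ideal and is inherited by both steps of the construction holds for it. -/
lemma vanishing_induction {P : Submodule ℂ (Superspace n) → Prop}
    (base : P (LinearMap.ker (augmentation n).toLinearMap))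
    (left : ∀ w K, P K → P (K ⊓ K.comap (contr w)))
    (right : ∀ b K, P K → P (K ⊓ K.comap (deriv b) ⊓ K.comap (contr b)))
    (W A : List (Fin n → ℂ)) : P (vanishing W A) := by
  induction A with
  | nil =>
    change P (vanishingBase W)
    induction W with
    | nil => exact base
    | cons w W ih => exact left _ _ ih
  | cons b A ih => exact right _ _ ih

lemma mul_poly_mem_vanishing (W A : List (Fin n → ℂ)) (p : MvPolynomial (Fin n) ℂ) :
    ∀ {a : Superspace n}, a ∈ vanishing W A → a * p ⊗ₜ 1 ∈ vanishing W A := by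
  refine vanishing_induction (P := fun K => ∀ p : MvPolynomial (Fin n) ℂ, ∀ {a : Superspace n},
    a ∈ K → a * p ⊗ₜ 1 ∈ K) ?_ ?_ ?_ W A p
  · intro p a ha
    have ha : augmentation n a = 0 := ha
    change augmentation n (a * p ⊗ₜ 1) = 0
    rw [map_mul, ha, zero_mul]
  · intro w K hK p a ha
    refine ⟨hK p ha.1, ?_⟩
    rw [SetLike.mem_coe, Submodule.mem_comap, contr_mul_poly]
    exact hK p ha.2
  · intro w K hK p a ha
    refine ⟨⟨hK p ha.1.1, ?_⟩, ?_⟩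
    · rw [SetLike.mem_coe, Submodule.mem_comap, deriv_mul, deriv_tmul]
      exact add_mem (hK p ha.1.2) (hK _ ha.1.1)
    · rw [SetLike.mem_coe, Submodule.mem_comap, contr_mul_poly]
      exact hK p ha.2

lemma mul_form_mem_vanishing (W A : List (Fin n → ℂ)) (v : Fin n → ℂ) :
    ∀ {a : Superspace n}, a ∈ vanishing W A → a * form v ∈ vanishing W A := by
  refine vanishing_induction (P := fun K => ∀ {a : Superspace n},
    a ∈ K → a * form v ∈ K) ?_ ?_ ?_ W A
  · intro a ha
    have ha : augmentation n a = 0 := ha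
    change augmentation n (a * _) = 0
    rw [map_mul, ha, zero_mul]
  · intro w K hK a ha
    refine ⟨hK ha.1, ?_⟩
    rw [SetLike.mem_coe, Submodule.mem_comap, contr_mul_form]
    exact sub_mem (K.smul_mem _ ha.1) (hK ha.2)
  · intro w K hK a ha
    refine ⟨⟨hK ha.1.1, ?_⟩, ?_⟩
    · rw [SetLike.mem_coe, Submodule.mem_comap, deriv_mul, deriv_form, mul_zero, add_zero]
      exact hK ha.1.2
    · rw [SetLike.mem_coe, Submodule.mem_comap, contr_mul_form]
      exact sub_mem (K.smul_mem _ ha.1.1) (hK ha.2)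

lemma parity_mem_vanishing (W A : List (Fin n → ℂ)) :
    ∀ {a : Superspace n}, a ∈ vanishing W A → parity a ∈ vanishing W A := by
  refine vanishing_induction (P := fun K => ∀ {a : Superspace n},
    a ∈ K → parity a ∈ K) ?_ ?_ ?_ W A
  · intro a ha
    have ha : augmentation n a = 0 := ha
    change augmentation n _ = 0
    rw [augmentation_parity, ha]
  · intro w K hK a ha
    refine ⟨hK ha.1, ?_⟩
    rw [SetLike.mem_coe, Submodule.mem_comap, ← neg_mem_iff, ← parity_contr]
    exact hK ha.2
  · intro w K hK a ha
    refine ⟨⟨hK ha.1.1, ?_⟩, ?_⟩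
    · rw [SetLike.mem_coe, Submodule.mem_comap, ← parity_deriv]
      exact hK ha.1.2
    · rw [SetLike.mem_coe, Submodule.mem_comap, ← neg_mem_iff, ← parity_contr]
      exact hK ha.2

/-- Superspace is generated as an algebra by polynomials and one-forms. -/
lemma mul_induction {P : Superspace n → Prop} (poly : ∀ p : MvPolynomial (Fin n) ℂ, P (p ⊗ₜ 1))
    (form : ∀ v, P (form v)) (add : ∀ a b, P a → P b → P (a + b))
    (mul : ∀ a b, P a → P b → P (a * b)) (a : Superspace n) : P a := by
  have key : ∀ ω : ExteriorAlgebra ℂ (Fin n → ℂ), P (1 ⊗ₜ ω) := by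
    intro ω
    induction ω using ExteriorAlgebra.induction with
    | algebraMap r =>
      have := poly (C r)
      rwa [← mul_one (C r), ← MvPolynomial.smul_eq_C_mul, TensorProduct.smul_tmul,
        ← Algebra.algebraMap_eq_smul_one] at this
    | ι v => exact form v
    | mul x y hx hy => simpa using mul _ _ hx hy
    | add x y hx hy => rw [TensorProduct.tmul_add]; exact add _ _ hx hy
  induction a using TensorProduct.induction_on with
  | zero => simpa using key 0
  | add x y hx hy => exact add _ _ hx hy
  | tmul p ω => simpa using mul _ _ (poly p) (key ω)

lemma mul_mem_vanishing (W A : List (Fin n → ℂ)) (b : Superspace n) :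
    ∀ {a : Superspace n}, a ∈ vanishing W A → a * b ∈ vanishing W A := by
  induction b using mul_induction with
  | poly p => exact mul_poly_mem_vanishing W A p
  | form v => exact mul_form_mem_vanishing W A v
  | add x y hx hy => intro a ha; rw [mul_add]; exact add_mem (hx ha) (hy ha)
  | mul x y hx hy => intro a ha; rw [← mul_assoc]; exact hy (hx ha)

lemma mul_mem_vanishing_left (W A : List (Fin n → ℂ)) (b : Superspace n) :
    ∀ {a : Superspace n}, a ∈ vanishing W A → b * a ∈ vanishing W A := by
  induction b using mul_induction with
  | poly p => intro a ha; rw [poly_mul_comm]; exact mul_poly_mem_vanishing W A p ha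
  | form v =>
    intro a ha; rw [form_mul_eq]
    exact mul_form_mem_vanishing W A v (parity_mem_vanishing W A ha)
  | add x y hx hy => intro a ha; rw [add_mul]; exact add_mem (hx ha) (hy ha)
  | mul x y hx hy => intro a ha; rw [mul_assoc]; exact hx (hy ha)

/-- By Cartan's formula, contracting d a along b produces `deriv b a`, which is controlled because b
may act by a derivative. This fails for directions that may only contract, hence the empty first
list. -/
lemma euler_mem_vanishing (A : List (Fin n → ℂ)) {a : Superspace n} (ha : a ∈ vanishing [] A) :
    euler a ∈ vanishing [] A := by
  induction A generalizing a with
  | nil =>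
    rw [mem_vanishing_nil, mem_vanishingBase_nil]
    simp [euler_apply]
  | cons b A ih =>
    rw [mem_vanishing_cons] at ha ⊢
    refine ⟨ih ha.1, ?_, ?_⟩
    · rw [deriv_euler]; exact ih ha.2.1
    · rw [contr_euler]; exact sub_mem ha.2.1 (ih ha.2.2)

/-! ### Powers of linear forms in the vanishing ideals -/

open Classical in
/-- The number of members of `A` that are not orthogonal to `v`. -/
def countNe (A : List (Fin n → ℂ)) (v : Fin n → ℂ) : ℕ := A.countP fun b => b ⬝ᵥ v ≠ 0

lemma countNe_cons_of_eq {A : List (Fin n → ℂ)} {b v : Fin n → ℂ} (h : b ⬝ᵥ v = 0) :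
    countNe (b :: A) v = countNe A v := by
  simp [countNe, h]

lemma countNe_cons_of_ne {A : List (Fin n → ℂ)} {b v : Fin n → ℂ} (h : b ⬝ᵥ v ≠ 0) :
    countNe (b :: A) v = countNe A v + 1 := by
  simp [countNe, h]

@[simp] lemma countNe_nil (v : Fin n → ℂ) : countNe [] v = 0 := rfl

lemma lin_mem_vanishingBase {W : List (Fin n → ℂ)} {v : Fin n → ℂ} :
    lin v ∈ vanishingBase W := by
  induction W with
  | nil => simp [mem_vanishingBase_nil]
  | cons w W ih =>
    refine mem_vanishingBase_cons.2 ⟨ih, ?_⟩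
    have := contr_lin_pow w v 1
    rw [pow_one] at this
    rw [this]; exact zero_mem _

lemma form_mem_vanishingBase {W : List (Fin n → ℂ)} {v : Fin n → ℂ}
    (hv : ∀ w ∈ W, w ⬝ᵥ v = 0) : form v ∈ vanishingBase W := by
  induction W with
  | nil => simp [mem_vanishingBase_nil]
  | cons w W ih =>
    refine mem_vanishingBase_cons.2 ⟨ih fun x hx => hv x (List.mem_cons_of_mem _ hx), ?_⟩
    rw [contr_form, hv w List.mem_cons_self, zero_smul]
    exact zero_mem _

lemma lin_pow_mem_vanishing (W A : List (Fin n → ℂ)) (v : Fin n → ℂ) :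
    lin v ^ (countNe A v + 1) ∈ vanishing W A := by
  induction A with
  | nil => simpa [mem_vanishing_nil] using lin_mem_vanishingBase
  | cons b A ih =>
    rw [mem_vanishing_cons, contr_lin_pow]
    by_cases h : b ⬝ᵥ v = 0
    · rw [countNe_cons_of_eq h, deriv_lin_pow_eq_zero h]
      exact ⟨ih, zero_mem _, zero_mem _⟩
    · rw [countNe_cons_of_ne h, deriv_lin_pow]
      refine ⟨?_, Submodule.smul_mem _ _ ih, zero_mem _⟩
      rw [pow_succ]
      exact mul_mem_vanishing _ _ _ ih

/-- A derivative along a non-orthogonal b lowers the power by one, matching the drop in the count. A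
contraction removes dλ instead and keeps the power, which then exceeds the remaining count by one.
-/
lemma lin_pow_mul_form_mem_vanishing {W : List (Fin n → ℂ)} (A : List (Fin n → ℂ))
    {v : Fin n → ℂ} (hv : ∀ w ∈ W, w ⬝ᵥ v = 0) :
    lin v ^ countNe A v * form v ∈ vanishing W A := by
  induction A with
  | nil => simpa [mem_vanishing_nil] using form_mem_vanishingBase hv
  | cons b A ih =>
    rw [mem_vanishing_cons, contr_mul_form, deriv_mul, contr_lin_pow, deriv_form]
    by_cases h : b ⬝ᵥ v = 0
    · rw [countNe_cons_of_eq h, deriv_lin_pow_eq_zero h, h]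
      simpa using ih
    · rw [countNe_cons_of_ne h, deriv_lin_pow]
      refine ⟨?_, ?_, ?_⟩
      · rw [pow_succ', mul_assoc]; exact mul_mem_vanishing_left _ _ _ ih
      · rw [mul_zero, add_zero, smul_mul_assoc]; exact Submodule.smul_mem _ _ ih
      · simpa using Submodule.smul_mem _ _ (lin_pow_mem_vanishing W A v)

/-! ### Lifting along a directional derivative -/

/-- The elements of bidegree `(i, j)` that are constant in the directions of `W`. -/
def piece (W : List (Fin n → ℂ)) (i j : ℕ) : Submodule ℂ (Superspace n) :=
  bidegree n i j ⊓ ⨅ w ∈ W, LinearMap.ker (deriv w)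

lemma mem_piece {W : List (Fin n → ℂ)} {i j : ℕ} {a : Superspace n} :
    a ∈ piece W i j ↔ a ∈ bidegree n i j ∧ ∀ w ∈ W, deriv w a = 0 := by
  simp [piece]

lemma mem_piece_cons {w : Fin n → ℂ} {W : List (Fin n → ℂ)} {i j : ℕ} {a : Superspace n} :
    a ∈ piece (w :: W) i j ↔ a ∈ piece W i j ∧ deriv w a = 0 := by
  simp only [mem_piece, List.mem_cons, forall_eq_or_imp]; tauto

lemma piece_nil (i j : ℕ) : piece ([] : List (Fin n → ℂ)) i j = bidegree n i j := by
  ext a; simp [mem_piece]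

lemma piece_zero (W : List (Fin n → ℂ)) (j : ℕ) : piece W 0 j = bidegree n 0 j := by
  ext a
  rw [mem_piece]
  exact ⟨fun h => h.1, fun h => ⟨h, fun w _ => deriv_eq_zero w h⟩⟩

lemma deriv_eq_zero_of_mem_span {W : List (Fin n → ℂ)} {i j : ℕ} {a : Superspace n}
    (ha : a ∈ piece W i j) {w : Fin n → ℂ} (hw : w ∈ Submodule.span ℂ {x | x ∈ W}) :
    deriv w a = 0 := by
  induction hw using Submodule.span_induction with
  | mem x hx => exact (mem_piece.1 ha).2 x hx
  | zero => rw [← zero_smul ℂ (0 : Fin n → ℂ), deriv_smul_left, zero_smul]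
  | add x y _ _ hx hy => rw [deriv_add_left, hx, hy, add_zero]
  | smul c x _ hx => rw [deriv_smul_left, hx, smul_zero]

lemma dotProduct_eq_zero_of_mem_span {W : List (Fin n → ℂ)} {b v : Fin n → ℂ}
    (hb : b ∈ Submodule.span ℂ {x | x ∈ W}) (hv : ∀ w ∈ W, w ⬝ᵥ v = 0) : b ⬝ᵥ v = 0 := by
  induction hb using Submodule.span_induction with
  | mem x hx => exact hv x hx
  | zero => simp
  | add x y _ _ hx hy => rw [add_dotProduct, hx, hy, add_zero]
  | smul c x _ hx => rw [smul_dotProduct, hx, smul_zero]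

lemma deriv_mem_piece (b : Fin n → ℂ) {W : List (Fin n → ℂ)} {i j : ℕ} {a : Superspace n}
    (ha : a ∈ piece W (i + 1) j) : deriv b a ∈ piece W i j := by
  rw [mem_piece] at ha ⊢
  refine ⟨deriv_mem_bidegree b ha.1, fun w hw => ?_⟩
  rw [deriv_comm, ha.2 w hw, map_zero]

lemma mul_lin_pow_mem_piece {W : List (Fin n → ℂ)} {i j : ℕ} {a : Superspace n}
    {v : Fin n → ℂ} (hv : ∀ w ∈ W, w ⬝ᵥ v = 0) (k : ℕ) (ha : a ∈ piece W i j) :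
    a * lin v ^ k ∈ piece W (i + k) j := by
  rw [mem_piece] at ha ⊢
  refine ⟨mul_lin_pow_mem_bidegree v k ha.1, fun w hw => ?_⟩
  rw [deriv_mul, ha.2 w hw, deriv_lin_pow_eq_zero (hv w hw), zero_mul, mul_zero, add_zero]

lemma mul_form_mem_piece {W : List (Fin n → ℂ)} {i j : ℕ} {a : Superspace n}
    (v : Fin n → ℂ) (ha : a ∈ piece W i j) : a * form v ∈ piece W i (j + 1) := by
  rw [mem_piece] at ha ⊢
  refine ⟨mul_form_mem_bidegree v ha.1, fun w hw => ?_⟩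
  rw [deriv_mul, ha.2 w hw, deriv_form, zero_mul, mul_zero, add_zero]

/-- Integration by parts: antiderivatives of `g λ^k` that are divisible by `λ^(k+1)`. -/
lemma exists_deriv_mul_lin_pow {W : List (Fin n → ℂ)} {b v : Fin n → ℂ}
    (hv : ∀ w ∈ W, w ⬝ᵥ v = 0) (hb : b ⬝ᵥ v ≠ 0) {j : ℕ} (i : ℕ) : ∀ (k : ℕ)
    {g : Superspace n}, g ∈ piece W i j →
      ∃ h ∈ piece W i j, deriv b (h * lin v ^ (k + 1)) = g * lin v ^ k := by
  induction i with
  | zero =>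
    intro k g hg
    have hk : ((k + 1 : ℂ) * (b ⬝ᵥ v)) ≠ 0 := mul_ne_zero (Nat.cast_add_one_ne_zero k) hb
    refine ⟨((k + 1 : ℂ) * (b ⬝ᵥ v))⁻¹ • g, Submodule.smul_mem _ _ hg, ?_⟩
    rw [deriv_mul, map_smul, deriv_eq_zero b (mem_piece.1 hg).1, smul_zero, zero_mul, zero_add,
      deriv_lin_pow, smul_mul_smul_comm, inv_mul_cancel₀ hk, one_smul]
  | succ i ih =>
    intro k g hg
    have hk : ((k + 1 : ℂ) * (b ⬝ᵥ v)) ≠ 0 := mul_ne_zero (Nat.cast_add_one_ne_zero k) hb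
    obtain ⟨h, hh, he⟩ := ih (k + 1) (deriv_mem_piece b hg)
    have hm := mul_lin_pow_mem_piece hv 1 hh
    rw [pow_one] at hm
    -- With c = (k+1)(b·v), ∂_b(g λ^(k+1)) = (∂_b g) λ^(k+1) + c g λ^k. The induction hypothesis
    -- writes the first summand as ∂_b(h λ^(k+2)), which is subtracted.
    refine ⟨((k + 1 : ℂ) * (b ⬝ᵥ v))⁻¹ • (g - h * lin v),
      Submodule.smul_mem _ _ (sub_mem hg hm), ?_⟩
    rw [smul_mul_assoc, map_smul, sub_mul, mul_assoc, ← pow_succ', map_sub, he, deriv_mul,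
      deriv_lin_pow, add_sub_cancel_left, mul_smul_comm, smul_smul, inv_mul_cancel₀ hk, one_smul]

/-- The span of the products `g λ_v^(ρ(v)+1)` and `g λ_v^ρ(v) dλ_v` of bidegree `(i, j)` with
`g` and `λ_v` constant in the directions of `W`. -/
def powerPiece (W A : List (Fin n → ℂ)) (i j : ℕ) : Submodule ℂ (Superspace n) :=
  Submodule.span ℂ {a | ∃ v, (∀ w ∈ W, w ⬝ᵥ v = 0) ∧
    ((∃ k, ∃ g ∈ piece W k j, k + (countNe A v + 1) = i ∧ a = g * lin v ^ (countNe A v + 1)) ∨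
    (∃ k l, ∃ g ∈ piece W k l, k + countNe A v = i ∧ l + 1 = j ∧
      a = g * lin v ^ countNe A v * form v))}

lemma mul_lin_pow_mem_powerPiece {W A : List (Fin n → ℂ)} {v : Fin n → ℂ}
    (hv : ∀ w ∈ W, w ⬝ᵥ v = 0) {k j : ℕ} {g : Superspace n} (hg : g ∈ piece W k j) :
    g * lin v ^ (countNe A v + 1) ∈ powerPiece W A (k + (countNe A v + 1)) j :=
  Submodule.subset_span ⟨v, hv, Or.inl ⟨k, g, hg, rfl, rfl⟩⟩

lemma mul_lin_pow_mul_form_mem_powerPiece {W A : List (Fin n → ℂ)} {v : Fin n → ℂ}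
    (hv : ∀ w ∈ W, w ⬝ᵥ v = 0) {k j : ℕ} {g : Superspace n} (hg : g ∈ piece W k j) :
    g * lin v ^ countNe A v * form v ∈ powerPiece W A (k + countNe A v) (j + 1) :=
  Submodule.subset_span ⟨v, hv, Or.inr ⟨k, j, g, hg, rfl, rfl, rfl⟩⟩

lemma powerPiece_le_piece (W A : List (Fin n → ℂ)) (i j : ℕ) :
    powerPiece W A i j ≤ piece W i j := by
  rw [powerPiece, Submodule.span_le]
  rintro a ⟨v, hv, (⟨k, g, hg, rfl, rfl⟩ | ⟨k, l, g, hg, rfl, rfl, rfl⟩)⟩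
  · exact mul_lin_pow_mem_piece hv _ hg
  · exact mul_form_mem_piece v (mul_lin_pow_mem_piece hv _ hg)

lemma powerPiece_le_vanishing (W A : List (Fin n → ℂ)) (i j : ℕ) :
    powerPiece W A i j ≤ vanishing W A := by
  rw [powerPiece, Submodule.span_le]
  rintro a ⟨v, hv, (⟨k, g, hg, rfl, rfl⟩ | ⟨k, l, g, hg, rfl, rfl, rfl⟩)⟩
  · exact mul_mem_vanishing_left _ _ _ (lin_pow_mem_vanishing W A v)
  · rw [mul_assoc]
    exact mul_mem_vanishing_left _ _ _ (lin_pow_mul_form_mem_vanishing A hv)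

/-- The rows of the transpose of a projection along `span W`. -/
lemma exists_orthogonal_family (W : List (Fin n → ℂ)) : ∃ u : Fin n → (Fin n → ℂ),
    (∀ l, ∀ w ∈ W, w ⬝ᵥ u l = 0) ∧
      ∀ b : Fin n → ℂ, b - (fun l => b ⬝ᵥ u l) ∈ Submodule.span ℂ {x | x ∈ W} := by
  obtain ⟨P, hP⟩ := LinearMap.exists_leftInverse_of_injective
    (Submodule.span ℂ {x | x ∈ W}).subtype (Submodule.ker_subtype _)
  -- P retracts onto the span of W, and pairing with the l-th vector reads off the l-th coordinate
  -- of b - P b.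
  have key : ∀ (b : Fin n → ℂ) (l : Fin n),
      b ⬝ᵥ (fun k => ((Pi.single k 1 : Fin n → ℂ) - P (Pi.single k 1)) l) =
        (b - P b) l := by
    intro b l
    have hb : b = ∑ k, b k • (Pi.single k 1 : Fin n → ℂ) := pi_eq_sum_univ' b
    have hPb : (P b : Fin n → ℂ) = ∑ k, b k • (P (Pi.single k 1) : Fin n → ℂ) := by
      conv_lhs => rw [hb]
      simp
    rw [Pi.sub_apply, hPb]
    simp [dotProduct, mul_sub, Finset.sum_sub_distrib, Pi.single_apply]
  refine ⟨fun l k => ((Pi.single k 1 : Fin n → ℂ) - P (Pi.single k 1)) l, fun l w hw => ?_,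
    fun b => ?_⟩
  · have h1 : P w = ⟨w, Submodule.subset_span hw⟩ :=
      congrArg (fun L => L ⟨w, Submodule.subset_span hw⟩) hP
    rw [key, h1]
    simp
  · convert (P b).2 using 1
    exact (congrArg (b - ·) (funext (key b))).trans (sub_sub_cancel _ _)

lemma exists_orthogonal_of_notMem_span {W : List (Fin n → ℂ)} {b : Fin n → ℂ}
    (hb : b ∉ Submodule.span ℂ {x | x ∈ W}) :
    ∃ v : Fin n → ℂ, (∀ w ∈ W, w ⬝ᵥ v = 0) ∧ b ⬝ᵥ v = 1 := by
  obtain ⟨u, hu, h⟩ := exists_orthogonal_family W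
  obtain ⟨l, hl⟩ : ∃ l, b ⬝ᵥ u l ≠ 0 := by
    by_contra! hc
    exact hb (by simpa [hc, ← Pi.zero_def] using h b)
  exact ⟨(b ⬝ᵥ u l)⁻¹ • u l, fun w hw => by simp [hu l w hw], by simp [hl]⟩

/-- Adding b to the list raises the exponent attached to v exactly when b is not orthogonal to v,
and exactly then an antiderivative can gain a power of λ_v. -/
lemma exists_deriv_eq_of_mem_powerPiece {W A : List (Fin n → ℂ)} {b : Fin n → ℂ}
    (hb : b ∉ Submodule.span ℂ {x | x ∈ W}) {i j : ℕ} {g : Superspace n}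
    (hg : g ∈ powerPiece W A i j) : ∃ f ∈ powerPiece W (b :: A) (i + 1) j, deriv b f = g := by
  obtain ⟨u, hu, hbu⟩ := exists_orthogonal_of_notMem_span hb
  have hbu : b ⬝ᵥ u ≠ 0 := by simp [hbu]
  suffices powerPiece W A i j ≤ (powerPiece W (b :: A) (i + 1) j).map (deriv b) from this hg
  clear hg g
  rw [powerPiece, Submodule.span_le]
  rintro a ⟨v, hv, (⟨k, g, hg, rfl, rfl⟩ | ⟨k, l, g, hg, rfl, rfl, rfl⟩)⟩
  all_goals by_cases hbv : b ⬝ᵥ v = 0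
  -- Here λ_v is constant along b, so only the factor g is integrated, using a linear form that is
  -- not constant along b.
  · obtain ⟨h, hh, he⟩ := exists_deriv_mul_lin_pow hu hbu k 0 hg
    rw [zero_add, pow_zero, mul_one] at he
    refine ⟨h * lin u ^ 1 * lin v ^ (countNe (b :: A) v + 1), ?_, ?_⟩
    rotate_left
    · rw [deriv_mul, he, deriv_lin_pow_eq_zero hbv, mul_zero, add_zero, countNe_cons_of_eq hbv]
    · rw [add_right_comm, ← countNe_cons_of_eq hbv]
      exact mul_lin_pow_mem_powerPiece hv (mul_lin_pow_mem_piece hu 1 hh)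
  · obtain ⟨h, hh, he⟩ := exists_deriv_mul_lin_pow hv hbv k (countNe A v + 1) hg
    refine ⟨_, ?_, he⟩
    rw [← countNe_cons_of_ne hbv, add_assoc]
    exact mul_lin_pow_mem_powerPiece hv hh
  · obtain ⟨h, hh, he⟩ := exists_deriv_mul_lin_pow hu hbu k 0 hg
    rw [zero_add, pow_zero, mul_one] at he
    refine ⟨h * lin u ^ 1 * lin v ^ countNe (b :: A) v * form v, ?_, ?_⟩
    rotate_left
    · rw [deriv_mul, deriv_mul, he, deriv_lin_pow_eq_zero hbv, deriv_form, mul_zero, mul_zero,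
        add_zero, add_zero, countNe_cons_of_eq hbv]
    · rw [add_right_comm, ← countNe_cons_of_eq hbv]
      exact mul_lin_pow_mul_form_mem_powerPiece hv (mul_lin_pow_mem_piece hu 1 hh)
  · obtain ⟨h, hh, he⟩ := exists_deriv_mul_lin_pow hv hbv k (countNe A v) hg
    refine ⟨h * lin v ^ countNe (b :: A) v * form v, ?_, ?_⟩
    · rw [add_assoc, ← countNe_cons_of_ne hbv]
      exact mul_lin_pow_mul_form_mem_powerPiece hv hh
    · rw [deriv_mul, deriv_form, mul_zero, add_zero, countNe_cons_of_ne hbv, he]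

lemma deriv_surjective_piece {W : List (Fin n → ℂ)} {b : Fin n → ℂ}
    (hb : b ∉ Submodule.span ℂ {x | x ∈ W}) {i j : ℕ} {g : Superspace n}
    (hg : g ∈ piece W i j) : ∃ f ∈ piece W (i + 1) j, deriv b f = g := by
  obtain ⟨u, hu, hbu⟩ := exists_orthogonal_of_notMem_span hb
  have hbu : b ⬝ᵥ u ≠ 0 := by simp [hbu]
  obtain ⟨h, hh, he⟩ := exists_deriv_mul_lin_pow hu hbu i 0 hg
  rw [pow_zero, mul_one] at he
  exact ⟨_, mul_lin_pow_mem_piece hu (0 + 1) hh, he⟩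

lemma sum_smul_lin (u : Fin n → ℂ) : ∑ k, u k • lin (Pi.single k 1) = lin u := by
  simp only [lin, TensorProduct.smul_tmul', ← TensorProduct.sum_tmul]
  congr 1
  simp [linearForm, Pi.single_apply, MvPolynomial.smul_eq_C_mul]

/-- With no hyperplanes the first powers λ_v generate everything of positive degree: Euler's
identity, rewritten with linear forms orthogonal to W. -/
lemma piece_succ_le_powerPiece_nil (W : List (Fin n → ℂ)) (i j : ℕ) :
    piece W (i + 1) j ≤ powerPiece W [] (i + 1) j := by
  intro a ha
  obtain ⟨u, hu, h⟩ := exists_orthogonal_family W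
  have hE := euler_identity (mem_piece.1 ha).1
  have hd : ∀ k, deriv (Pi.single k 1) a = ∑ l, u l k • deriv (Pi.single l 1) a := by
    intro k
    have h0 := deriv_eq_zero_of_mem_span ha (h (Pi.single k 1))
    have h1 := deriv_add_left (Pi.single k 1 - fun l => Pi.single k 1 ⬝ᵥ u l)
      (fun l => Pi.single k 1 ⬝ᵥ u l) a
    rw [sub_add_cancel, h0, zero_add] at h1
    rw [h1, deriv_eq_sum]
    simp
  have hsum : ((i + 1 : ℕ) : ℂ) • a = ∑ l, deriv (Pi.single l 1) a * lin (u l) := by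
    rw [← hE]
    simp_rw [← sum_smul_lin (u _), Finset.mul_sum]
    rw [Finset.sum_comm]
    refine Finset.sum_congr rfl fun k _ => ?_
    rw [hd k, Finset.sum_mul]
    refine Finset.sum_congr rfl fun l _ => ?_
    rw [smul_mul_assoc, mul_smul_comm]
  have hmem : ((i + 1 : ℕ) : ℂ) • a ∈ powerPiece W [] (i + 1) j := by
    rw [hsum]
    refine Submodule.sum_mem _ fun l _ => ?_
    have := mul_lin_pow_mem_powerPiece (A := []) (hu l) (deriv_mem_piece (Pi.single l 1) ha)
    simpa using this
  exact (Submodule.smul_mem_iff _ (Nat.cast_ne_zero.2 i.succ_ne_zero)).1 hmem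

/-! ### Bosonic degree zero: constant forms -/

/-- Each member of the list lies outside the span of the members that follow it. -/
def Indep : List (Fin n → ℂ) → Prop
  | [] => True
  | w :: W => w ∉ Submodule.span ℂ {x | x ∈ W} ∧ Indep W

lemma indep_nil : Indep ([] : List (Fin n → ℂ)) := trivial

/-- The multiples of the one-forms orthogonal to `W`. -/
def formSpan (W : List (Fin n → ℂ)) (j : ℕ) : Submodule ℂ (Superspace n) :=
  Submodule.span ℂ {a | ∃ v, (∀ w ∈ W, w ⬝ᵥ v = 0) ∧ ∃ l, ∃ g ∈ bidegree n 0 l, l + 1 = j ∧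
    a = g * form v}

lemma mul_form_mem_formSpan {W : List (Fin n → ℂ)} {v : Fin n → ℂ}
    (hv : ∀ w ∈ W, w ⬝ᵥ v = 0) {l : ℕ} {g : Superspace n} (hg : g ∈ bidegree n 0 l) :
    g * form v ∈ formSpan W (l + 1) :=
  Submodule.subset_span ⟨v, hv, l, g, hg, rfl, rfl⟩

lemma formSpan_le_vanishingBase (W : List (Fin n → ℂ)) (j : ℕ) :
    formSpan W j ≤ vanishingBase W := by
  rw [formSpan, Submodule.span_le]
  rintro a ⟨v, hv, l, g, hg, rfl, rfl⟩
  exact mul_mem_vanishing_left W [] g (form_mem_vanishingBase hv)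

lemma formSpan_mul_form {W : List (Fin n → ℂ)} {j : ℕ} {a : Superspace n}
    (ha : a ∈ formSpan W j) (v : Fin n → ℂ) : a * form v ∈ formSpan W (j + 1) := by
  suffices formSpan W j ≤ (formSpan W (j + 1)).comap (LinearMap.mulRight ℂ (form v)) from this ha
  rw [formSpan, Submodule.span_le]
  rintro a ⟨u, hu, l, g, hg, rfl, rfl⟩
  change g * form u * form v ∈ formSpan W _
  rw [mul_assoc, form_mul_swap, mul_smul_comm, ← mul_assoc]
  exact Submodule.smul_mem _ _ <| mul_form_mem_formSpan hu (mul_form_mem_bidegree v hg)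

/-- Each u orthogonal to W splits as u - (w·u) v, orthogonal also to w, plus a multiple of v. -/
lemma exists_formSpan_cons {w : Fin n → ℂ} {W : List (Fin n → ℂ)} {v : Fin n → ℂ}
    (hv : ∀ x ∈ W, x ⬝ᵥ v = 0) (hwv : w ⬝ᵥ v = 1) {j : ℕ} {a : Superspace n}
    (ha : a ∈ formSpan W (j + 1)) :
    ∃ b ∈ formSpan (w :: W) (j + 1), ∃ c ∈ bidegree n 0 j, a = b + c * form v := by
  induction ha using Submodule.span_induction with
  | mem x hx =>
    obtain ⟨u, hu, l, g, hg, hl, rfl⟩ := hx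
    obtain rfl : l = j := by omega
    refine ⟨g * form (u - (w ⬝ᵥ u) • v), mul_form_mem_formSpan ?_ hg, (w ⬝ᵥ u) • g,
      Submodule.smul_mem _ _ hg, ?_⟩
    · intro x hx
      rcases List.mem_cons.1 hx with rfl | hx
      · simp [dotProduct_sub, hwv]
      · simp [dotProduct_sub, hu x hx, hv x hx]
    · rw [sub_eq_add_neg, ← neg_smul, form_add, form_smul, mul_add, mul_smul_comm,
        smul_mul_assoc, add_assoc, ← add_smul, neg_add_cancel, zero_smul, add_zero]
  | zero => exact ⟨0, zero_mem _, 0, zero_mem _, by simp⟩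
  | add x y _ _ hx hy =>
    obtain ⟨b, hb, c, hc, rfl⟩ := hx
    obtain ⟨b', hb', c', hc', rfl⟩ := hy
    exact ⟨b + b', add_mem hb hb', c + c', add_mem hc hc', by rw [add_mul]; abel⟩
  | smul r x _ hx =>
    obtain ⟨b, hb, c, hc, rfl⟩ := hx
    exact ⟨r • b, Submodule.smul_mem _ _ hb, r • c, Submodule.smul_mem _ _ hc, by
      rw [smul_add, smul_mul_assoc]⟩

lemma bidegree_zero_inf_vanishingBase_le {W : List (Fin n → ℂ)} (hW : Indep W) (j : ℕ) :
    bidegree n 0 j ⊓ vanishingBase W ≤ formSpan W j := by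
  induction W generalizing j with
  | nil =>
    rintro a ⟨ha, h⟩
    cases j with
    | zero =>
      have : a = algebraMap ℂ _ (augmentation n a) := by
        have := map_mem_of_tmul (LinearMap.id - Algebra.linearMap ℂ (Superspace n) ∘ₗ
          (augmentation n).toLinearMap) ⊥ (fun p ω hp hω => by
            obtain ⟨c, rfl⟩ := exists_algebraMap hω
            obtain ⟨d, rfl⟩ : ∃ c, p = C c := ⟨_, (totalDegree_eq_zero_iff_eq_C).1 (by
              simpa using hp.totalDegree_le)⟩
            have h1 : (C d : MvPolynomial (Fin n) ℂ) = d • 1 := by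
              rw [MvPolynomial.smul_eq_C_mul, mul_one]
            simp [Algebra.algebraMap_eq_smul_one, h1, Algebra.TensorProduct.one_def,
              TensorProduct.smul_tmul', TensorProduct.tmul_smul, smul_smul]) ha
        simpa [sub_eq_zero] using this
      rw [this, mem_vanishingBase_nil.1 h, map_zero]
      exact zero_mem _
    | succ j =>
      refine Submodule.span_le.2 ?_ (bidegree_succ_le_span 0 j ha)
      rintro _ ⟨b, hb, v, rfl⟩
      exact mul_form_mem_formSpan (by simp) hb
  | cons w W ih =>
    rintro a ⟨ha, h⟩
    obtain ⟨h1, h2⟩ := mem_vanishingBase_cons.1 h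
    cases j with
    | zero =>
      have := ih hW.2 0 ⟨ha, h1⟩
      have h0 : formSpan W 0 = ⊥ := by
        rw [formSpan, Submodule.span_eq_bot]
        rintro _ ⟨v, hv, l, g, hg, hl, rfl⟩
        omega
      rw [h0, Submodule.mem_bot] at this
      rw [this]; exact zero_mem _
    | succ j =>
      obtain ⟨v, hv, hwv⟩ := exists_orthogonal_of_notMem_span hW.1
      obtain ⟨b, hb, c, hc, rfl⟩ := exists_formSpan_cons hv hwv (ih hW.2 _ ⟨ha, h1⟩)
      refine add_mem hb ?_
      have hb2 := (mem_vanishingBase_cons.1 (formSpan_le_vanishingBase _ _ hb)).2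
      have hf := form_mem_vanishingBase hv
      rw [map_add, contr_mul_form, hwv, one_smul] at h2
      -- Contracting b + c dv along w leaves c, up to terms already known to vanish under W.
      have hc2 : c ∈ vanishingBase W := by
        have := sub_mem h2 hb2
        rw [add_sub_cancel_left] at this
        simpa using add_mem this (mul_mem_vanishing_left W [] (contr w c) hf)
      have hcm := ih hW.2 j ⟨hc, hc2⟩
      cases j with
      | zero =>
        have h0 : formSpan W 0 = ⊥ := by
          rw [formSpan, Submodule.span_eq_bot]
          rintro _ ⟨v, hv, l, g, hg, hl, rfl⟩
          omega
        rw [h0, Submodule.mem_bot] at hcm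
        rw [hcm, zero_mul]; exact zero_mem _
      | succ j =>
        -- Splitting c in turn as b' + c' dv, the second term disappears from c dv because dv
        -- squares to zero.
        obtain ⟨b', hb', c', hc', rfl⟩ := exists_formSpan_cons hv hwv hcm
        rw [add_mul, mul_assoc, form_mul_self, mul_zero, add_zero]
        exact formSpan_mul_form hb' v

/-! ### Vanishing ideals are generated by powers -/

/-- The elements of the vanishing ideal of each bidegree are generated by powers. -/
theorem piece_inf_vanishing_le_powerPiece {W : List (Fin n → ℂ)} (hW : Indep W)
    (A : List (Fin n → ℂ)) (i j : ℕ) :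
    piece W i j ⊓ vanishing W A ≤ powerPiece W A i j := by
  induction A generalizing W i j with
  | nil =>
    rintro a ⟨ha, h⟩
    cases i with
    | succ i => exact piece_succ_le_powerPiece_nil W i j ha
    | zero =>
      rw [piece_zero] at ha
      refine Submodule.span_le.2 ?_ (bidegree_zero_inf_vanishingBase_le hW j ⟨ha, h⟩)
      rintro _ ⟨v, hv, l, g, hg, rfl, rfl⟩
      rw [← piece_zero W] at hg
      simpa using mul_lin_pow_mul_form_mem_powerPiece (A := []) hv hg
  | cons b A ih =>
    rintro a ⟨ha, h⟩
    obtain ⟨h1, h2, h3⟩ := mem_vanishing_cons.1 h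
    by_cases hb : b ∈ Submodule.span ℂ {x | x ∈ W}
    · have hc : ∀ v : Fin n → ℂ, (∀ w ∈ W, w ⬝ᵥ v = 0) → countNe (b :: A) v = countNe A v := by
        intro v hv
        exact countNe_cons_of_eq (dotProduct_eq_zero_of_mem_span hb hv)
      have : powerPiece W A i j ≤ powerPiece W (b :: A) i j := by
        refine Submodule.span_le.2 ?_
        rintro a ⟨v, hv, (⟨k, g, hg, rfl, rfl⟩ | ⟨k, l, g, hg, rfl, rfl, rfl⟩)⟩
        · rw [← hc v hv]
          exact mul_lin_pow_mem_powerPiece hv hg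
        · rw [← hc v hv]
          exact mul_lin_pow_mul_form_mem_powerPiece hv hg
      exact this (ih hW i j ⟨ha, h1⟩)
    -- Vectors orthogonal to b do not see b in the count, so generators of the contraction are
    -- generators of the original problem.
    · have hle : ∀ i, powerPiece (b :: W) A i j ≤ powerPiece W (b :: A) i j := by
        intro i
        refine Submodule.span_le.2 ?_
        rintro a ⟨v, hv, (⟨k, g, hg, rfl, rfl⟩ | ⟨k, l, g, hg, rfl, rfl, rfl⟩)⟩
        · rw [← countNe_cons_of_eq (hv b List.mem_cons_self)]
          exact mul_lin_pow_mem_powerPiece (fun w hw => hv w (List.mem_cons_of_mem _ hw))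
            (mem_piece_cons.1 hg).1
        · rw [← countNe_cons_of_eq (hv b List.mem_cons_self)]
          exact mul_lin_pow_mul_form_mem_powerPiece (fun w hw => hv w (List.mem_cons_of_mem _ hw))
            (mem_piece_cons.1 hg).1
      have key : ∀ {i} {a : Superspace n}, a ∈ piece W i j → a ∈ vanishing W (b :: A) →
          deriv b a = 0 → a ∈ powerPiece W (b :: A) i j := by
        intro i a ha h h0
        refine hle i (ih (W := b :: W) ⟨hb, hW⟩ i j ⟨mem_piece_cons.2 ⟨ha, h0⟩, ?_⟩)
        have h := mem_vanishing_cons.1 h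
        exact mem_vanishing_cons_left.2 ⟨h.1, h.2.2⟩
      cases i with
      | zero => exact key ha h (deriv_eq_zero b (mem_piece.1 ha).1)
      | succ i =>
        -- By the deletion case ∂_b a is a combination of powers. After subtracting a lift f of it,
        -- the difference is constant along b and falls under the contraction case.
        obtain ⟨f, hf, he⟩ := exists_deriv_eq_of_mem_powerPiece hb
          (ih hW i j ⟨deriv_mem_piece b ha, h2⟩)
        have := key (sub_mem ha (powerPiece_le_piece _ _ _ _ hf))
          (sub_mem h (powerPiece_le_vanishing _ _ _ _ hf)) (by rw [map_sub, he, sub_self])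
        simpa using add_mem this hf

end Superspace

/-! ### Dimensions modulo a subspace -/

section RelDim

variable {E E' : Type*} [AddCommGroup E] [Module ℂ E] [AddCommGroup E'] [Module ℂ E']

lemma finrank_map_add_finrank_inf_ker (V : Submodule ℂ E) [FiniteDimensional ℂ V]
    (f : E →ₗ[ℂ] E') : Module.finrank ℂ (V.map f) +
      Module.finrank ℂ (V ⊓ LinearMap.ker f : Submodule ℂ E) = Module.finrank ℂ V := by
  rw [← LinearMap.finrank_range_add_finrank_ker (f.domRestrict V), LinearMap.range_domRestrict,
    LinearMap.ker_domRestrict, ← Submodule.map_comap_subtype,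
    Submodule.finrank_map_subtype_eq]

/-- The dimension of the image of `V` modulo `N`. -/
def relDim (V N : Submodule ℂ E) : ℕ := Module.finrank ℂ (V.map N.mkQ)

lemma relDim_add_finrank_inf (V N : Submodule ℂ E) [FiniteDimensional ℂ V] :
    relDim V N + Module.finrank ℂ (V ⊓ N : Submodule ℂ E) = Module.finrank ℂ V := by
  have := finrank_map_add_finrank_inf_ker V N.mkQ
  rwa [Submodule.ker_mkQ] at this

lemma finrank_map_eq_relDim (V N : Submodule ℂ E) [FiniteDimensional ℂ V] (f : E →ₗ[ℂ] E')
    (h : V ⊓ LinearMap.ker f = V ⊓ N) : Module.finrank ℂ (V.map f) = relDim V N := by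
  have h1 := finrank_map_add_finrank_inf_ker V f
  have h2 := relDim_add_finrank_inf V N
  rw [h] at h1
  omega

lemma relDim_congr {V N N' : Submodule ℂ E} [FiniteDimensional ℂ V]
    (h : ∀ a ∈ V, a ∈ N ↔ a ∈ N') : relDim V N = relDim V N' := by
  refine finrank_map_eq_relDim V N' N.mkQ ?_
  ext a
  simp only [Submodule.ker_mkQ, Submodule.mem_inf]
  exact and_congr_right (h a)

lemma relDim_eq_zero {V N : Submodule ℂ E} (h : V ≤ N) : relDim V N = 0 := by
  have : V.map N.mkQ = ⊥ := by
    rw [eq_bot_iff]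
    rintro _ ⟨a, ha, rfl⟩
    exact (Submodule.Quotient.mk_eq_zero N).2 (h ha)
  rw [relDim, this, finrank_bot]

lemma relDim_eq_of_map_eq {V N : Submodule ℂ E} {V' N' : Submodule ℂ E'}
    [FiniteDimensional ℂ V] [FiniteDimensional ℂ V'] (T : E →ₗ[ℂ] E') (hV : V.map T = V')
    (hN : ∀ a ∈ V, a ∈ N ↔ T a ∈ N') : relDim V N = relDim V' N' := by
  have h := finrank_map_eq_relDim V N (N'.mkQ ∘ₗ T) (by
    ext a
    simp only [LinearMap.ker_comp, Submodule.ker_mkQ, Submodule.mem_inf, Submodule.mem_comap]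
    exact and_congr_right fun ha => (hN a ha).symm)
  rw [← h, Submodule.map_comp, hV, relDim]

/-- Additivity of the relative dimension in a short exact sequence `Vk → V → V'`. -/
lemma relDim_eq_add_of_exact {V Vk N Nk : Submodule ℂ E} {V' N' : Submodule ℂ E'}
    [FiniteDimensional ℂ V] [FiniteDimensional ℂ V'] [FiniteDimensional ℂ Vk]
    (T : E →ₗ[ℂ] E') (hV : V.map T = V') (hN : (V ⊓ N).map T = V' ⊓ N')
    (hk : V ⊓ LinearMap.ker T = Vk) (hkN : ∀ a ∈ Vk, a ∈ N ↔ a ∈ Nk) :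
    relDim V N = relDim V' N' + relDim Vk Nk := by
  have h1 := finrank_map_add_finrank_inf_ker V T
  have : FiniteDimensional ℂ (V ⊓ N : Submodule ℂ E) :=
    Submodule.finiteDimensional_of_le inf_le_left
  have h2 := finrank_map_add_finrank_inf_ker (V ⊓ N) T
  have h3 : V ⊓ N ⊓ LinearMap.ker T = Vk ⊓ Nk := by
    rw [inf_right_comm, hk]
    ext a
    exact and_congr_right (hkN a)
  rw [hV, hk] at h1
  rw [hN, h3] at h2
  have := relDim_add_finrank_inf V N
  have := relDim_add_finrank_inf V' N'
  have := relDim_add_finrank_inf Vk Nk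
  omega

/-- The quotient of V by M is an extension of V modulo N by V ⊓ N modulo M, and T identifies the
latter with V' modulo N'. -/
lemma relDim_eq_add_of_surjective {V N M : Submodule ℂ E} {V' N' : Submodule ℂ E'}
    [FiniteDimensional ℂ V] (T : E →ₗ[ℂ] E') (hV : ∀ a ∈ V, T a ∈ V')
    (hs : ∀ b ∈ V', ∃ a ∈ V ⊓ N, T a - b ∈ N')
    (hM : ∀ a ∈ V, a ∈ M ↔ a ∈ N ∧ T a ∈ N') :
    relDim V M = relDim V N + relDim V' N' := by
  have : FiniteDimensional ℂ (V ⊓ N : Submodule ℂ E) :=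
    Submodule.finiteDimensional_of_le inf_le_left
  have h1 := finrank_map_add_finrank_inf_ker (V ⊓ N) (N'.mkQ ∘ₗ T)
  have h2 : (V ⊓ N).map (N'.mkQ ∘ₗ T) = V'.map N'.mkQ := by
    apply le_antisymm
    · rintro _ ⟨a, ha, rfl⟩
      exact ⟨T a, hV a ha.1, rfl⟩
    · rintro _ ⟨b, hb, rfl⟩
      obtain ⟨a, ha, hab⟩ := hs b hb
      exact ⟨a, ha, (Submodule.Quotient.eq N').2 hab⟩
  have h3 : V ⊓ N ⊓ LinearMap.ker (N'.mkQ ∘ₗ T) = V ⊓ M := by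
    ext a
    simp only [LinearMap.ker_comp, Submodule.ker_mkQ, Submodule.mem_inf, Submodule.mem_comap,
      and_assoc]
    exact and_congr_right fun ha => (hM a ha).symm
  rw [h2, h3] at h1
  have := relDim_add_finrank_inf V N
  have := relDim_add_finrank_inf V M
  have : relDim V' N' = Module.finrank ℂ (V'.map N'.mkQ) := rfl
  omega

end RelDim

/-! ### Deletion-contraction for the bigraded dimensions -/

namespace Superspace

open MvPolynomial

variable {n : ℕ}

/-- The exponent of the monomial `q^i t^j`. -/
def qtExp (i j : ℕ) : Fin 2 →₀ ℕ := Finsupp.single 0 i + Finsupp.single 1 j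

lemma qtExp_apply_zero (i j : ℕ) : qtExp i j 0 = i := by simp [qtExp]

lemma qtExp_apply_one (i j : ℕ) : qtExp i j 1 = j := by simp [qtExp]

lemma eq_qtExp (e : Fin 2 →₀ ℕ) : e = qtExp (e 0) (e 1) := by
  ext k
  fin_cases k <;> simp [qtExp]

lemma coeff_succ_X_zero_mul (i j : ℕ) (p : MvPolynomial (Fin 2) ℕ) :
    coeff (qtExp (i + 1) j) (X 0 * p) = coeff (qtExp i j) p := by
  rw [← coeff_X_mul (qtExp i j) 0 p]
  congr 1
  rw [qtExp, qtExp, Finsupp.single_add]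
  abel

lemma coeff_zero_X_zero_mul (j : ℕ) (p : MvPolynomial (Fin 2) ℕ) :
    coeff (qtExp 0 j) (X 0 * p) = 0 := by
  rw [coeff_X_mul', if_neg]
  simp [qtExp]

lemma coeff_succ_X_one_mul (i j : ℕ) (p : MvPolynomial (Fin 2) ℕ) :
    coeff (qtExp i (j + 1)) (X 1 * p) = coeff (qtExp i j) p := by
  rw [← coeff_X_mul (qtExp i j) 1 p]
  congr 1
  rw [qtExp, qtExp, Finsupp.single_add]
  abel

lemma coeff_zero_X_one_mul (i : ℕ) (p : MvPolynomial (Fin 2) ℕ) :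
    coeff (qtExp i 0) (X 1 * p) = 0 := by
  rw [coeff_X_mul', if_neg]
  simp [qtExp]

instance (W : List (Fin n → ℂ)) (i j : ℕ) : FiniteDimensional ℂ (piece W i j) :=
  Submodule.finiteDimensional_of_le (S₂ := bidegree n i j) inf_le_left

lemma bidegree_succ_le_vanishingBase (W : List (Fin n → ℂ)) (i j : ℕ) :
    bidegree n (i + 1) j ≤ vanishingBase W := by
  induction W generalizing j with
  | nil => exact fun a ha => augmentation_eq_zero_of_pos_left ha
  | cons w W ih =>
    intro a ha
    refine mem_vanishingBase_cons.2 ⟨ih j ha, ?_⟩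
    cases j with
    | zero => rw [contr_eq_zero w ha]; exact zero_mem _
    | succ j => exact ih j (contr_mem_bidegree w ha)

lemma relDim_bidegree_zero_zero :
    relDim (bidegree n 0 0) (vanishingBase ([] : List (Fin n → ℂ))) = 1 := by
  have h := relDim_eq_of_map_eq (V := bidegree n 0 0) (N := vanishingBase []) (V' := ⊤) (N' := ⊥)
    (augmentation n).toLinearMap (by
      rw [eq_top_iff]
      rintro c -
      refine ⟨c • 1, Submodule.smul_mem _ _ ?_, by simp⟩
      rw [Algebra.TensorProduct.one_def]
      exact tmul_mem_bidegree (isHomogeneous_one _ _)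
        (by rw [exteriorPower_zero_eq]; exact Submodule.one_le.1 le_rfl))
    (fun a _ => Iff.rfl)
  have h2 := relDim_add_finrank_inf (⊤ : Submodule ℂ ℂ) ⊥
  rw [inf_bot_eq, finrank_bot, add_zero, finrank_top, Module.finrank_self] at h2
  rw [h, h2]

lemma coeff_one_add_X_pow_succ (i j k : ℕ) :
    coeff (qtExp (i + 1) j) ((1 + X 1 : MvPolynomial (Fin 2) ℕ) ^ k) = 0 := by
  induction k generalizing j with
  | zero =>
    rw [pow_zero, coeff_one, if_neg]
    intro h
    simpa [qtExp] using congrArg (fun e => e 0) h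
  | succ k ih =>
    rw [pow_succ', add_mul, one_mul, coeff_add, ih]
    cases j with
    | zero => rw [coeff_zero_X_one_mul]
    | succ j => rw [coeff_succ_X_one_mul, ih]

/-- Without derivatives only constant forms survive. A new independent w adds forms c dv with v dual
to w and orthogonal to W, whence a factor 1 + t. -/
lemma relDim_vanishingBase {W : List (Fin n → ℂ)} (hW : Indep W) (i j : ℕ) :
    relDim (piece W i j) (vanishingBase W) =
      coeff (qtExp i j) ((1 + X 1 : MvPolynomial (Fin 2) ℕ) ^ W.length) := by
  cases i with
  | succ i =>
    rw [coeff_one_add_X_pow_succ, relDim_eq_zero]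
    exact inf_le_left.trans (bidegree_succ_le_vanishingBase W i j)
  | zero =>
    rw [piece_zero]
    induction W generalizing j with
    | nil =>
      rw [List.length_nil, pow_zero]
      cases j with
      | zero => rw [relDim_bidegree_zero_zero]; simp [qtExp]
      | succ j =>
        rw [relDim_eq_zero fun a ha => augmentation_eq_zero_of_pos_right ha, coeff_one, if_neg]
        intro h
        simpa [qtExp] using congrArg (fun e => e 1) h
    | cons w W ih =>
      rw [List.length_cons, pow_succ', add_mul, one_mul, coeff_add, ← ih hW.2]
      cases j with
      | zero =>
        rw [coeff_zero_X_one_mul, add_zero]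
        refine relDim_congr fun a ha => ?_
        rw [mem_vanishingBase_cons, contr_eq_zero w ha]
        exact and_iff_left (zero_mem _)
      | succ j =>
        rw [coeff_succ_X_one_mul, ← ih hW.2]
        obtain ⟨v, hv, hwv⟩ := exists_orthogonal_of_notMem_span hW.1
        have hf := form_mem_vanishingBase hv
        refine relDim_eq_add_of_surjective (contr w) (fun a ha => contr_mem_bidegree w ha)
          (fun b hb => ⟨b * form v, ⟨mul_form_mem_bidegree v hb,
            mul_mem_vanishing_left W [] b hf⟩, ?_⟩) (fun a _ => mem_vanishingBase_cons)
        rw [contr_mul_form, hwv, one_smul, sub_sub_cancel_left, neg_mem_iff]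
        exact mul_mem_vanishing_left W [] _ hf

open Classical in
/-- The deletion-contraction polynomial of the list `A`, after contracting the list `W`. -/
def hilbPoly : List (Fin n → ℂ) → List (Fin n → ℂ) → MvPolynomial (Fin 2) ℕ
  | [], W => (1 + X 1) ^ W.length
  | b :: A, W => if b ∈ Submodule.span ℂ {x | x ∈ W} then hilbPoly A W
      else X 0 * hilbPoly A W + hilbPoly A (b :: W)

/-- The deletion-contraction recursion for the Hilbert series. -/
theorem relDim_vanishing {W : List (Fin n → ℂ)} (hW : Indep W) (A : List (Fin n → ℂ))
    (i j : ℕ) : relDim (piece W i j) (vanishing W A) = coeff (qtExp i j) (hilbPoly A W) := by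
  induction A generalizing W i j with
  | nil => exact relDim_vanishingBase hW i j
  | cons b A ih =>
    rw [hilbPoly]
    split_ifs with hb
    · rw [← ih hW]
      refine relDim_congr fun a ha => ?_
      rw [mem_vanishing_cons, deriv_eq_zero_of_mem_span ha hb]
      exact ⟨fun h => h.1, fun h => ⟨h, zero_mem _, contr_mem_vanishing A hb h⟩⟩
    · have hbW : Indep (b :: W) := ⟨hb, hW⟩
      have hker : ∀ a : Superspace n, deriv b a = 0 →
          (a ∈ vanishing W (b :: A) ↔ a ∈ vanishing (b :: W) A) := by
        intro a h
        rw [mem_vanishing_cons, mem_vanishing_cons_left, h]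
        simp
      cases i with
      | zero =>
        rw [coeff_add, coeff_zero_X_zero_mul, zero_add, ← ih hbW, piece_zero, piece_zero]
        exact relDim_congr fun a ha => hker a (deriv_eq_zero b ha)
      | succ i =>
        rw [coeff_add, coeff_succ_X_zero_mul, ← ih hbW, ← ih hW]
        refine relDim_eq_add_of_exact (deriv b) ?_ ?_ ?_
          (fun a ha => hker a (mem_piece_cons.1 ha).2)
        · apply le_antisymm
          · rintro _ ⟨a, ha, rfl⟩
            exact deriv_mem_piece b ha
          · intro g hg
            exact deriv_surjective_piece hb hg
        · apply le_antisymm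
          · rintro _ ⟨a, ha, rfl⟩
            exact ⟨deriv_mem_piece b ha.1, (mem_vanishing_cons.1 ha.2).2.1⟩
          · intro g hg
            -- Relations lift because they are combinations of powers; this is what makes the
            -- sequence of quotients exact.
            obtain ⟨f, hf, he⟩ := exists_deriv_eq_of_mem_powerPiece hb
              (piece_inf_vanishing_le_powerPiece hW A i j hg)
            exact ⟨f, ⟨powerPiece_le_piece _ _ _ _ hf, powerPiece_le_vanishing _ _ _ _ hf⟩, he⟩
        · ext a
          rw [mem_piece_cons]
          rfl

end Superspace

lemma quotientPieceDim_eq_relDim {R : Type*} [Ring R] [Algebra ℂ R] (I : Ideal R)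
    (V : Submodule ℂ R) [FiniteDimensional ℂ V] :
    quotientPieceDim I V = relDim V (I.restrictScalars ℂ) := by
  refine finrank_map_eq_relDim V _ _ ?_
  ext a
  simp

/-! ### Identification of the superspace ideal of an arrangement -/

namespace Multiarrangement

variable {n m : ℕ} (A : Multiarrangement n m)

/-- The list of normal vectors. -/
def normals : List (Fin n → ℂ) := List.ofFn A.normal

lemma le_hyperplane_iff (l : Fin n → ℂ) (i : Fin m) :
    Submodule.span ℂ {l} ≤ A.hyperplane i ↔ A.normal i ⬝ᵥ l = 0 := by
  rw [Submodule.span_singleton_le_iff_mem, hyperplane, LinearMap.mem_ker]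
  simp [dotProduct]

lemma rho_span_singleton (l : Fin n → ℂ) :
    A.rho (Submodule.span ℂ {l}) = Superspace.countNe A.normals l := by
  classical
  rw [rho, Superspace.countNe, normals, List.ofFn_eq_map, List.countP_map,
    Set.ncard_eq_toFinset_card']
  simp only [le_hyperplane_iff, Set.toFinset_ofPred]
  rw [List.countP_eq_length_filter, Finset.card_def, Finset.filter_val, Fin.univ_def,
    Multiset.filter_coe, Multiset.coe_card]
  simp [Function.comp_def]

lemma pow_mem_powerIdeal {l : Fin n → ℂ} (hl : l ≠ 0) (k : ℕ) :
    linearForm l ^ (Superspace.countNe A.normals l + k) ∈ A.powerIdeal k :=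
  Ideal.subset_span ⟨l, hl, by rw [rho_span_singleton]⟩

end Multiarrangement

namespace Superspace

open MvPolynomial

variable {n m : ℕ}

@[simp] lemma lin_zero : lin (0 : Fin n → ℂ) = 0 := by simp [lin, linearForm]

@[simp] lemma form_zero : form (0 : Fin n → ℂ) = 0 := by simp [form]

lemma sum_smul_form (u : Fin n → ℂ) : ∑ k, u k • form (Pi.single k 1) = form u := by
  simp only [form, ← TensorProduct.tmul_smul, ← TensorProduct.tmul_sum, ← map_smul, ← map_sum]
  rw [← pi_eq_sum_univ' u]

lemma euler_lin_pow (v : Fin n → ℂ) (k : ℕ) :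
    euler (lin v ^ (k + 1)) = (k + 1 : ℂ) • (lin v ^ k * form v) := by
  rw [euler_apply, ← sum_smul_form v, Finset.mul_sum, Finset.smul_sum]
  refine Finset.sum_congr rfl fun i _ => ?_
  rw [deriv_lin_pow, smul_mul_assoc, mul_smul_comm, smul_smul, single_one_dotProduct]

lemma lin_pow_mem_superIdeal (A : Multiarrangement n m) (v : Fin n → ℂ) :
    lin v ^ (countNe A.normals v + 1) ∈ A.superIdeal := by
  refine Submodule.mem_sInf.2 fun K hK => ?_
  rcases eq_or_ne v 0 with rfl | hv
  · rw [lin_zero, zero_pow (Nat.succ_ne_zero _)]; exact zero_mem _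
  · rw [lin_pow]
    exact hK.2.1 _ (A.pow_mem_powerIdeal hv 1)

lemma lin_pow_mul_form_mem_superIdeal (A : Multiarrangement n m) (v : Fin n → ℂ) :
    lin v ^ countNe A.normals v * form v ∈ A.superIdeal := by
  refine Submodule.mem_sInf.2 fun K hK => ?_
  -- d(λ^(ρ+1)) = (ρ+1) λ^ρ dλ, and the scalar is invertible.
  have h := hK.2.2 _ (Submodule.mem_sInf.1 (lin_pow_mem_superIdeal A v) K hK)
  rw [euler_lin_pow] at h
  have h2 := (K.restrictScalars ℂ).smul_mem ((countNe A.normals v + 1 : ℂ)⁻¹) h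
  rwa [smul_smul, inv_mul_cancel₀ (Nat.cast_add_one_ne_zero _), one_smul] at h2

lemma powerPiece_le_superIdeal (A : Multiarrangement n m) (i j : ℕ) :
    powerPiece [] A.normals i j ≤ A.superIdeal.restrictScalars ℂ := by
  refine Submodule.span_le.2 ?_
  rintro a ⟨v, hv, (⟨k, g, hg, rfl, rfl⟩ | ⟨k, l, g, hg, rfl, rfl, rfl⟩)⟩
  · exact A.superIdeal.mul_mem_left _ (lin_pow_mem_superIdeal A v)
  · rw [mul_assoc]
    exact A.superIdeal.mul_mem_left _ (lin_pow_mul_form_mem_superIdeal A v)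

/-- The space `vanishing W A` as a left ideal. -/
def vanishingIdeal (W A : List (Fin n → ℂ)) : Ideal (Superspace n) where
  carrier := vanishing W A
  add_mem' := add_mem
  zero_mem' := zero_mem _
  smul_mem' b _ ha := mul_mem_vanishing_left W A b ha

lemma superIdeal_le_vanishing (A : Multiarrangement n m) {a : Superspace n}
    (ha : a ∈ A.superIdeal) : a ∈ vanishing [] A.normals := by
  -- The vanishing ideal is one of the competitors in the infimum defining the differential closure.
  refine Submodule.mem_sInf.1 ha (vanishingIdeal [] A.normals)
    ⟨⟨fun b h => mul_mem_vanishing [] A.normals b h⟩, fun f hf => ?_,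
      fun w hw => euler_mem_vanishing _ hw⟩
  change f ⊗ₜ 1 ∈ vanishing [] A.normals
  induction hf using Submodule.span_induction with
  | mem x hx =>
    obtain ⟨l, hl, rfl⟩ := hx
    rw [A.rho_span_singleton, ← lin_pow]
    exact lin_pow_mem_vanishing [] _ l
  | zero => rw [TensorProduct.zero_tmul]; exact zero_mem _
  | add x y _ _ hx hy => rw [TensorProduct.add_tmul]; exact add_mem hx hy
  | smul p x _ hx =>
    rw [smul_eq_mul, mul_comm]
    simpa using mul_poly_mem_vanishing [] _ p hx

lemma mem_superIdeal_iff (A : Multiarrangement n m) {i j : ℕ} {a : Superspace n}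
    (ha : a ∈ bidegree n i j) : a ∈ A.superIdeal ↔ a ∈ vanishing [] A.normals := by
  refine ⟨superIdeal_le_vanishing A, fun h => ?_⟩
  rw [← piece_nil] at ha
  exact powerPiece_le_superIdeal A i j (piece_inf_vanishing_le_powerPiece indep_nil _ i j ⟨ha, h⟩)

lemma mem_powerPiece_of_mem_superIdeal (A : Multiarrangement n m) {i j : ℕ} {a : Superspace n}
    (ha : a ∈ bidegree n i j) (h : a ∈ A.superIdeal) : a ∈ powerPiece [] A.normals i j := by
  rw [← piece_nil] at ha
  exact piece_inf_vanishing_le_powerPiece indep_nil _ i j ⟨ha, superIdeal_le_vanishing A h⟩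

/-- The Hilbert series of the superspace quotient is the deletion-contraction polynomial. -/
theorem quotientPieceDim_superIdeal (A : Multiarrangement n m) (i j : ℕ) :
    quotientPieceDim A.superIdeal (bidegree n i j) =
      coeff (qtExp i j) (hilbPoly A.normals []) := by
  rw [quotientPieceDim_eq_relDim, ← relDim_vanishing indep_nil, piece_nil]
  exact relDim_congr fun a ha => mem_superIdeal_iff A ha

/-! ### Fermionic degree zero: the external algebra -/

/-- Apply a functional to the exterior factor of superspace. -/
def polyPart (φ : ExteriorAlgebra ℂ (Fin n → ℂ) →ₗ[ℂ] ℂ) :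
    Superspace n →ₗ[ℂ] MvPolynomial (Fin n) ℂ :=
  (TensorProduct.rid ℂ _).toLinearMap ∘ₗ LinearMap.lTensor _ φ

@[simp] lemma polyPart_tmul (φ : ExteriorAlgebra ℂ (Fin n → ℂ) →ₗ[ℂ] ℂ)
    (p : MvPolynomial (Fin n) ℂ) (ω : ExteriorAlgebra ℂ (Fin n → ℂ)) :
    polyPart φ (p ⊗ₜ ω) = φ ω • p := by
  simp [polyPart]

lemma polyPart_mul_poly (φ : ExteriorAlgebra ℂ (Fin n → ℂ) →ₗ[ℂ] ℂ) (a : Superspace n)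
    (q : MvPolynomial (Fin n) ℂ) : polyPart φ (a * q ⊗ₜ 1) = polyPart φ a * q := by
  induction a using TensorProduct.induction_on with
  | zero => simp
  | add x y hx hy => simp only [add_mul, map_add, hx, hy]
  | tmul p ω => simp

lemma polyPart_mul_lin_pow (φ : ExteriorAlgebra ℂ (Fin n → ℂ) →ₗ[ℂ] ℂ) (a : Superspace n)
    (v : Fin n → ℂ) (k : ℕ) :
    polyPart φ (a * lin v ^ k) = polyPart φ a * linearForm v ^ k := by
  rw [lin_pow, polyPart_mul_poly]

lemma map_polyPart_bidegree (φ : ExteriorAlgebra ℂ (Fin n → ℂ) →ₗ[ℂ] ℂ) (i j : ℕ)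
    {ω : ExteriorAlgebra ℂ (Fin n → ℂ)} (hω : ω ∈ ⋀[ℂ]^j (Fin n → ℂ)) (h : φ ω = 1) :
    (bidegree n i j).map (polyPart φ) = homogeneousSubmodule (Fin n) ℂ i := by
  apply le_antisymm
  · rintro _ ⟨a, ha, rfl⟩
    refine map_mem_of_tmul (polyPart φ) _ (fun p η hp _ => ?_) ha
    rw [polyPart_tmul]
    exact Submodule.smul_mem _ _ hp
  · intro p hp
    exact ⟨p ⊗ₜ ω, tmul_mem_bidegree hp hω, by rw [polyPart_tmul, h, one_smul]⟩

instance (i : ℕ) : FiniteDimensional ℂ (homogeneousSubmodule (Fin n) ℂ i) :=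
  Module.Finite.iff_fg.2 (homogeneousSubmodule_fg _ _ i)

theorem quotientPieceDim_bidegree_zero (A : Multiarrangement n m) (i : ℕ) :
    quotientPieceDim A.superIdeal (bidegree n i 0) =
      quotientPieceDim (A.powerIdeal 1) (homogeneousSubmodule (Fin n) ℂ i) := by
  rw [quotientPieceDim_eq_relDim, quotientPieceDim_eq_relDim]
  refine relDim_eq_of_map_eq (polyPart ExteriorAlgebra.algebraMapInv.toLinearMap)
    (map_polyPart_bidegree _ i 0 (ω := 1)
      (by rw [exteriorPower_zero_eq]; exact Submodule.one_le.1 le_rfl) (by simp))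
    (fun a ha => ⟨fun h => ?_, fun h => ?_⟩)
  · suffices powerPiece [] A.normals i 0 ≤ ((A.powerIdeal 1).restrictScalars ℂ).comap
        (polyPart ExteriorAlgebra.algebraMapInv.toLinearMap) from
      this (mem_powerPiece_of_mem_superIdeal A ha h)
    refine Submodule.span_le.2 ?_
    rintro a ⟨v, hv, (⟨k, g, hg, rfl, rfl⟩ | ⟨k, l, g, hg, hk, hl, rfl⟩)⟩
    · change polyPart _ _ ∈ A.powerIdeal 1
      rw [polyPart_mul_lin_pow]
      rcases eq_or_ne v 0 with rfl | hv0
      · simp [linearForm]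
      · exact Ideal.mul_mem_left _ _ (A.pow_mem_powerIdeal hv0 1)
    -- Generators with a factor dλ have positive fermionic degree.
    · omega
  · have key : a = polyPart ExteriorAlgebra.algebraMapInv.toLinearMap a ⊗ₜ 1 := by
      have := map_mem_of_tmul (LinearMap.id - (TensorProduct.mk ℂ (MvPolynomial (Fin n) ℂ)
        (ExteriorAlgebra ℂ (Fin n → ℂ))).flip 1 ∘ₗ
          polyPart ExteriorAlgebra.algebraMapInv.toLinearMap) ⊥ (fun p ω hp hω => by
            obtain ⟨c, rfl⟩ := exists_algebraMap hω
            simp [Algebra.algebraMap_eq_smul_one, TensorProduct.smul_tmul']) ha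
      simpa [sub_eq_zero] using this
    change a ∈ A.superIdeal
    rw [key]
    exact Submodule.mem_sInf.2 fun K hK => hK.2.1 _ h

/-! ### Top fermionic degree: the central algebra -/

/-- Iterated interior product with the members of `W`, followed by the augmentation. -/
def extFunctional : List (Fin n → ℂ) → (ExteriorAlgebra ℂ (Fin n → ℂ) →ₗ[ℂ] ℂ)
  | [] => ExteriorAlgebra.algebraMapInv.toLinearMap
  | w :: W => extFunctional W ∘ₗ extContr w

lemma extFunctional_cons (w : Fin n → ℂ) (W : List (Fin n → ℂ))
    (ω : ExteriorAlgebra ℂ (Fin n → ℂ)) :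
    extFunctional (w :: W) ω = extFunctional W (extContr w ω) := rfl

lemma extFunctional_mul_ι {W : List (Fin n → ℂ)} {v : Fin n → ℂ} (hv : ∀ w ∈ W, w ⬝ᵥ v = 0)
    (ω : ExteriorAlgebra ℂ (Fin n → ℂ)) :
    extFunctional W (ω * ExteriorAlgebra.ι ℂ v) = 0 := by
  induction W generalizing ω with
  | nil => simp [extFunctional, ExteriorAlgebra.algebraMapInv]
  | cons w W ih =>
    rw [extFunctional_cons, extContr_mul_ι, hv w List.mem_cons_self, zero_smul, zero_sub, map_neg,
      ih (fun x hx => hv x (List.mem_cons_of_mem _ hx)), neg_zero]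

lemma polyPart_mul_form {W : List (Fin n → ℂ)} {v : Fin n → ℂ} (hv : ∀ w ∈ W, w ⬝ᵥ v = 0)
    (a : Superspace n) : polyPart (extFunctional W) (a * form v) = 0 := by
  induction a using TensorProduct.induction_on with
  | zero => simp
  | add x y hx hy => simp only [add_mul, map_add, hx, hy, add_zero]
  | tmul p ω => simp [form, extFunctional_mul_ι hv]

lemma exists_extFunctional_eq_one {W : List (Fin n → ℂ)} (hW : Indep W) :
    ∃ ω ∈ ⋀[ℂ]^W.length (Fin n → ℂ), extFunctional W ω = 1 := by
  induction W with
  | nil =>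
    exact ⟨1, by rw [List.length_nil, exteriorPower_zero_eq]; exact Submodule.one_le.1 le_rfl,
      by simp [extFunctional]⟩
  | cons w W ih =>
    obtain ⟨ω, hω, h⟩ := ih hW.2
    obtain ⟨v, hv, hwv⟩ := exists_orthogonal_of_notMem_span hW.1
    refine ⟨ω * ExteriorAlgebra.ι ℂ v, ?_, ?_⟩
    · rw [List.length_cons, exteriorPower_succ_eq]
      exact Submodule.mul_mem_mul hω ⟨v, rfl⟩
    · rw [extFunctional_cons, extContr_mul_ι, hwv, one_smul, map_sub, h, extFunctional_mul_ι hv,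
        sub_zero]

lemma mem_vanishingBase_of_length_lt {W : List (Fin n → ℂ)} {j : ℕ} (hj : W.length < j)
    {a : Superspace n} (ha : a ∈ bidegree n 0 j) : a ∈ vanishingBase W := by
  induction W generalizing j a with
  | nil =>
    obtain ⟨j, rfl⟩ := Nat.exists_eq_add_one_of_ne_zero (show j ≠ 0 by simp at hj; omega)
    exact augmentation_eq_zero_of_pos_right ha
  | cons w W ih =>
    rw [List.length_cons] at hj
    obtain ⟨j, rfl⟩ := Nat.exists_eq_add_one_of_ne_zero (show j ≠ 0 by omega)
    exact mem_vanishingBase_cons.2 ⟨ih (by omega) ha, ih (by omega) (contr_mem_bidegree w ha)⟩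

/-- In degree |W| any product of fewer contractions leaves a form of positive degree, which the
augmentation kills; only the full contraction is a condition. -/
lemma mem_vanishingBase_of_extFunctional_eq_zero {W : List (Fin n → ℂ)}
    {ω : ExteriorAlgebra ℂ (Fin n → ℂ)} (hω : ω ∈ ⋀[ℂ]^W.length (Fin n → ℂ))
    (h : extFunctional W ω = 0) : (1 ⊗ₜ ω : Superspace n) ∈ vanishingBase W := by
  induction W generalizing ω with
  | nil =>
    rw [mem_vanishingBase_nil, augmentation_tmul]
    exact mul_eq_zero_of_right _ h
  | cons w W ih =>
    refine mem_vanishingBase_cons.2 ⟨mem_vanishingBase_of_length_lt (j := W.length + 1)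
      (by omega) (tmul_mem_bidegree (isHomogeneous_one _ _) hω), ?_⟩
    exact ih (extContr_mem w _ hω) h

lemma exists_indep (L : List (Fin n → ℂ)) : ∃ W : List (Fin n → ℂ), Indep W ∧
    Submodule.span ℂ {x | x ∈ W} = Submodule.span ℂ {x | x ∈ L} := by
  induction L with
  | nil => exact ⟨[], trivial, rfl⟩
  | cons b L ih =>
    obtain ⟨W, hW, h⟩ := ih
    have hins : ∀ (b : Fin n → ℂ) (L : List (Fin n → ℂ)), Submodule.span ℂ {x | x ∈ b :: L} =
        Submodule.span ℂ {b} ⊔ Submodule.span ℂ {x | x ∈ L} := by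
      intro b L
      rw [← Submodule.span_insert]
      congr 1
      ext x
      simp
    by_cases hb : b ∈ Submodule.span ℂ {x | x ∈ W}
    · refine ⟨W, hW, ?_⟩
      rw [hins, ← h, eq_comm, sup_eq_right, Submodule.span_singleton_le_iff_mem]
      exact hb
    · exact ⟨b :: W, ⟨hb, hW⟩, by rw [hins, hins, h]⟩

lemma finrank_span_cons {w : Fin n → ℂ} {S : Set (Fin n → ℂ)}
    (hw : w ∉ Submodule.span ℂ S) : Module.finrank ℂ (Submodule.span ℂ (insert w S)) =
      Module.finrank ℂ (Submodule.span ℂ S) + 1 := by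
  have hw0 : w ≠ 0 := fun h => hw (h ▸ zero_mem _)
  have hd : Disjoint (Submodule.span ℂ S) (Submodule.span ℂ {w}) :=
    (Submodule.disjoint_span_singleton' hw0).2 hw
  have := Submodule.finrank_sup_add_finrank_inf_eq (Submodule.span ℂ S) (Submodule.span ℂ {w})
  rw [hd.eq_bot, finrank_bot, finrank_span_singleton hw0, add_zero] at this
  rw [Submodule.span_insert, sup_comm, this]

lemma finrank_span_of_indep {W : List (Fin n → ℂ)} (hW : Indep W) :
    Module.finrank ℂ (Submodule.span ℂ {x | x ∈ W}) = W.length := by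
  induction W with
  | nil => simp
  | cons w W ih =>
    have h : {x | x ∈ w :: W} = insert w {x | x ∈ W} := by ext x; simp
    rw [h, List.length_cons, ← ih hW.2, ← finrank_span_cons hW.1]

lemma span_normals (A : Multiarrangement n m) :
    {x | x ∈ A.normals} = A.normal '' ((Finset.univ : Finset (Fin m)) : Set (Fin m)) := by
  ext x
  simp [Multiarrangement.normals, List.mem_ofFn]

lemma countNe_eq_zero_iff {L : List (Fin n → ℂ)} {v : Fin n → ℂ} :
    countNe L v = 0 ↔ ∀ b ∈ L, b ⬝ᵥ v = 0 := by
  simp [countNe, List.countP_eq_zero]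

lemma mul_pow_mem_essCentralIdeal (A : Multiarrangement n m) (p : MvPolynomial (Fin n) ℂ)
    (v : Fin n → ℂ) {k : ℕ} (hk : max (countNe A.normals v) 1 ≤ k) :
    p * linearForm v ^ k ∈ A.essCentralIdeal := by
  rcases eq_or_ne v 0 with rfl | hv
  · have : linearForm (0 : Fin n → ℂ) ^ k = 0 := by
      simp [linearForm]; omega
    simp [this]
  · obtain ⟨c, rfl⟩ := Nat.exists_eq_add_of_le' hk
    rw [pow_add, ← mul_assoc]
    exact Ideal.mul_mem_left _ _ (Ideal.subset_span ⟨v, hv, by rw [A.rho_span_singleton]⟩)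

section TopForm

variable (A : Multiarrangement n m) {W : List (Fin n → ℂ)}

/-- A vector orthogonal to all normals has ρ = 0, so dλ itself lies in the ideal. -/
lemma formSpan_le_superIdeal
    (hWA : Submodule.span ℂ {x | x ∈ W} = Submodule.span ℂ {x | x ∈ A.normals}) (j : ℕ) :
    formSpan W j ≤ A.superIdeal.restrictScalars ℂ := by
  refine Submodule.span_le.2 ?_
  rintro _ ⟨v, hv, l, g, hg, rfl, rfl⟩
  have h0 : countNe A.normals v = 0 := countNe_eq_zero_iff.2 fun b hb =>
    dotProduct_eq_zero_of_mem_span (hWA ▸ Submodule.subset_span hb) hv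
  have := lin_pow_mul_form_mem_superIdeal A v
  rw [h0, pow_zero, one_mul] at this
  exact A.superIdeal.mul_mem_left g this

lemma pow_tmul_mem_superIdeal (hW : Indep W)
    (hWA : Submodule.span ℂ {x | x ∈ W} = Submodule.span ℂ {x | x ∈ A.normals})
    {ω : ExteriorAlgebra ℂ (Fin n → ℂ)} (hω : ω ∈ ⋀[ℂ]^W.length (Fin n → ℂ)) (v : Fin n → ℂ) :
    lin v ^ max (countNe A.normals v) 1 * 1 ⊗ₜ ω ∈ A.superIdeal := by
  by_cases h0 : countNe A.normals v = 0
  · have := lin_pow_mem_superIdeal A v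
    rw [h0] at this ⊢
    rw [lin_pow_comm]
    exact A.superIdeal.mul_mem_left _ this
  rw [max_eq_left (by omega)]
  obtain ⟨w, hw, hwv⟩ : ∃ w ∈ W, w ⬝ᵥ v ≠ 0 := by
    by_contra! hc
    exact h0 (countNe_eq_zero_iff.2 fun b hb =>
      dotProduct_eq_zero_of_mem_span (hWA ▸ Submodule.subset_span hb) hc)
  have hω' : (1 ⊗ₜ ω : Superspace n) ∈ bidegree n 0 W.length :=
    tmul_mem_bidegree (isHomogeneous_one _ _) hω
  have hmul := mul_form_mem_bidegree v hω'
  -- Since ι_w(ω dλ) = (w·v) ω - ι_w(ω) dλ, the form ω is recovered from two terms. The product ω dλ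
  -- has degree |W| + 1, too large to be detected by W, so ι_w(ω dλ) lies in the ideal; the other
  -- term lies there after multiplication by λ^ρ.
  have h1 : contr w (1 ⊗ₜ ω * form v) ∈ formSpan W W.length :=
    bidegree_zero_inf_vanishingBase_le hW _ ⟨contr_mem_bidegree w hmul,
      contr_mem_vanishing_of_mem [] hw (mem_vanishingBase_of_length_lt (Nat.lt_succ_self _) hmul)⟩
  have h2 := A.superIdeal.mul_mem_left (lin v ^ countNe A.normals v)
    (formSpan_le_superIdeal A hWA _ h1)
  have h3 := A.superIdeal.mul_mem_left (contr w (1 ⊗ₜ ω)) (lin_pow_mul_form_mem_superIdeal A v)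
  rw [← mul_assoc, ← lin_pow_comm, mul_assoc] at h3
  have h4 := A.superIdeal.add_mem h2 h3
  rw [← mul_add, contr_mul_form, sub_add_cancel, mul_smul_comm] at h4
  have h5 := (A.superIdeal.restrictScalars ℂ).smul_mem (w ⬝ᵥ v)⁻¹ h4
  rwa [smul_smul, inv_mul_cancel₀ hwv, one_smul] at h5

/-- The list W is a basis of the span of the normals. Modulo the ideal every form of degree |W| is a
multiple of one ω, and `extFunctional W` reads off its polynomial coefficient. -/
theorem quotientPieceDim_bidegree_length (hW : Indep W)
    (hWA : Submodule.span ℂ {x | x ∈ W} = Submodule.span ℂ {x | x ∈ A.normals}) (i : ℕ) :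
    quotientPieceDim A.superIdeal (bidegree n i W.length) =
      quotientPieceDim A.essCentralIdeal (homogeneousSubmodule (Fin n) ℂ i) := by
  rw [quotientPieceDim_eq_relDim, quotientPieceDim_eq_relDim]
  obtain ⟨ω, hω, h1⟩ := exists_extFunctional_eq_one hW
  refine relDim_eq_of_map_eq (polyPart (extFunctional W)) (map_polyPart_bidegree _ i _ hω h1)
    (fun a ha => ⟨fun h => ?_, fun h => ?_⟩)
  · suffices powerPiece [] A.normals i W.length ≤ (A.essCentralIdeal.restrictScalars ℂ).comap
        (polyPart (extFunctional W)) from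
      this (mem_powerPiece_of_mem_superIdeal A ha h)
    refine Submodule.span_le.2 ?_
    rintro a ⟨v, hv, (⟨k, g, hg, rfl, rfl⟩ | ⟨k, l, g, hg, hk, hl, rfl⟩)⟩
    · change polyPart _ _ ∈ A.essCentralIdeal
      rw [polyPart_mul_lin_pow]
      exact mul_pow_mem_essCentralIdeal A _ v (by omega)
    · change polyPart _ _ ∈ A.essCentralIdeal
      by_cases h0 : countNe A.normals v = 0
      · rw [polyPart_mul_form fun w hw => dotProduct_eq_zero_of_mem_span
          (hWA ▸ Submodule.subset_span hw) (countNe_eq_zero_iff.1 h0)]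
        exact zero_mem _
      · rw [mul_assoc, lin_pow_comm, ← mul_assoc, polyPart_mul_lin_pow]
        exact mul_pow_mem_essCentralIdeal A _ v (by omega)
  · have key : a - polyPart (extFunctional W) a ⊗ₜ ω ∈ A.superIdeal.restrictScalars ℂ := by
      refine map_mem_of_tmul (LinearMap.id - (TensorProduct.mk ℂ (MvPolynomial (Fin n) ℂ)
        (ExteriorAlgebra ℂ (Fin n → ℂ))).flip ω ∘ₗ polyPart (extFunctional W)) _
          (fun p η hp hη => ?_) ha
      have hη2 : η - extFunctional W η • ω ∈ ⋀[ℂ]^W.length (Fin n → ℂ) :=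
        sub_mem hη (Submodule.smul_mem _ _ hω)
      have h2 := formSpan_le_superIdeal A hWA _ (bidegree_zero_inf_vanishingBase_le hW _
        ⟨tmul_mem_bidegree (isHomogeneous_one _ _) hη2,
          mem_vanishingBase_of_extFunctional_eq_zero hη2 (by simp [h1])⟩)
      have h3 := A.superIdeal.mul_mem_left (p ⊗ₜ 1) h2
      rw [Algebra.TensorProduct.tmul_mul_tmul, mul_one, one_mul] at h3
      simpa [TensorProduct.tmul_sub, TensorProduct.smul_tmul'] using h3
    have h2 : polyPart (extFunctional W) a ⊗ₜ ω ∈ A.superIdeal := by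
      have h : polyPart (extFunctional W) a ∈ A.essCentralIdeal := h
      generalize polyPart (extFunctional W) a = f at h
      induction h using Submodule.span_induction with
      | mem x hx =>
        obtain ⟨v, hv, rfl⟩ := hx
        have := pow_tmul_mem_superIdeal A hW hWA hω v
        rw [lin_pow] at this
        rw [A.rho_span_singleton]
        simpa using this
      | zero => rw [TensorProduct.zero_tmul]; exact zero_mem _
      | add x y _ _ hx hy => rw [TensorProduct.add_tmul]; exact add_mem hx hy
      | smul p x _ hx =>
        simpa using A.superIdeal.mul_mem_left (p ⊗ₜ 1) hx
    have := A.superIdeal.add_mem key h2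
    simpa using this

end TopForm

/-- When the normals span, no nonzero vector is orthogonal to all of them, so ρ is at least 1 on
every line. -/
lemma powerIdeal_zero_eq_essCentralIdeal (A : Multiarrangement n m) (h : A.rank = n) :
    A.powerIdeal 0 = A.essCentralIdeal := by
  have htop : Submodule.span ℂ {x | x ∈ A.normals} = ⊤ := by
    apply Submodule.eq_top_of_finrank_eq
    rw [span_normals, Module.finrank_fin_fun]
    exact h
  have key : ∀ l : Fin n → ℂ, l ≠ 0 → A.rho (Submodule.span ℂ {l}) + 0 =
      max (A.rho (Submodule.span ℂ {l})) 1 := by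
    intro l hl
    have : countNe A.normals l ≠ 0 := by
      intro h0
      refine hl (funext fun k => ?_)
      have := dotProduct_eq_zero_of_mem_span (b := Pi.single k 1) (htop ▸ Submodule.mem_top)
        (countNe_eq_zero_iff.1 h0)
      simpa using this
    rw [A.rho_span_singleton]
    omega
  unfold Multiarrangement.powerIdeal Multiarrangement.essCentralIdeal
  congr 1
  ext f
  refine exists_congr fun l => and_congr_right fun hl => ?_
  rw [key l hl]

/-! ### The summand of top degree and the characteristic polynomial -/

lemma homogeneousComponent_succ_X_mul {σ R : Type*} [CommSemiring R] (s : σ) (k : ℕ)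
    (p : MvPolynomial σ R) :
    homogeneousComponent (k + 1) (X s * p) = X s * homogeneousComponent k p := by
  classical
  ext d
  rw [coeff_homogeneousComponent, coeff_X_mul', coeff_X_mul', coeff_homogeneousComponent]
  by_cases hs : s ∈ d.support
  · have hd : (d - Finsupp.single s 1).degree + 1 = d.degree := by
      have h1 : Finsupp.single s 1 ≤ d := by
        rw [Finsupp.single_le_iff]
        exact Nat.one_le_iff_ne_zero.2 (Finsupp.mem_support_iff.1 hs)
      conv_rhs => rw [← tsub_add_cancel_of_le h1]
      rw [map_add, Finsupp.degree_single]
    simp only [hs, if_true, ← hd, add_left_inj]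
  · simp [hs]

lemma totalDegree_hilbPoly_le (A W : List (Fin n → ℂ)) :
    (hilbPoly A W).totalDegree ≤ A.length + W.length := by
  induction A generalizing W with
  | nil =>
    rw [hilbPoly, List.length_nil, zero_add]
    refine (totalDegree_pow _ _).trans ?_
    have : (1 + X 1 : MvPolynomial (Fin 2) ℕ).totalDegree ≤ 1 :=
      (totalDegree_add _ _).trans (by simp)
    simpa using Nat.mul_le_mul_left W.length this
  | cons b A ih =>
    rw [hilbPoly, List.length_cons]
    split_ifs
    · have := ih W; omega
    · refine (totalDegree_add _ _).trans (max_le ((totalDegree_mul _ _).trans ?_) ?_)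
      · have := ih W
        rw [totalDegree_X]; omega
      · have := ih (b :: W)
        rw [List.length_cons] at this; omega

/-- The summand of degree `|A| + |W|` of `hilbPoly A W`. -/
def hilbTop (A W : List (Fin n → ℂ)) : MvPolynomial (Fin 2) ℕ :=
  homogeneousComponent (A.length + W.length) (hilbPoly A W)

lemma hilbTop_nil (W : List (Fin n → ℂ)) : hilbTop [] W = X 1 ^ W.length := by
  rw [hilbTop, hilbPoly, List.length_nil, zero_add]
  generalize W.length = k
  induction k with
  | zero => simp
  | succ k ih =>
    rw [pow_succ', add_mul, one_mul, map_add, homogeneousComponent_succ_X_mul, ih, pow_succ',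
      homogeneousComponent_eq_zero, zero_add]
    refine Nat.lt_succ_of_le ((totalDegree_pow _ _).trans ?_)
    have : (1 + X 1 : MvPolynomial (Fin 2) ℕ).totalDegree ≤ 1 :=
      (totalDegree_add _ _).trans (by simp)
    simpa using Nat.mul_le_mul_left k this

/-- A vector in the span of W lengthens the list without raising the degree of the polynomial. -/
lemma hilbTop_cons_of_mem {b : Fin n → ℂ} {A W : List (Fin n → ℂ)}
    (hb : b ∈ Submodule.span ℂ {x | x ∈ W}) : hilbTop (b :: A) W = 0 := by
  rw [hilbTop, hilbPoly, if_pos hb, List.length_cons]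
  apply homogeneousComponent_eq_zero
  have := totalDegree_hilbPoly_le A W
  omega

lemma hilbTop_cons_of_notMem {b : Fin n → ℂ} {A W : List (Fin n → ℂ)}
    (hb : b ∉ Submodule.span ℂ {x | x ∈ W}) :
    hilbTop (b :: A) W = X 0 * hilbTop A W + hilbTop A (b :: W) := by
  rw [hilbTop, hilbPoly, if_neg hb, List.length_cons, map_add, add_right_comm,
    homogeneousComponent_succ_X_mul, hilbTop, hilbTop, List.length_cons, add_assoc]

/-- Always deleting is possible because a nonzero vector is not in the span of the empty list. The
resulting monomial in q forces the total degree to equal the number of hyperplanes. -/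
lemma coeff_hilbPoly_ne_zero {A : List (Fin n → ℂ)} (hA : ∀ b ∈ A, b ≠ 0) :
    coeff (qtExp A.length 0) (hilbPoly A []) ≠ 0 := by
  induction A with
  | nil => simp [hilbPoly, qtExp]
  | cons b A ih =>
    have hb : b ∉ Submodule.span ℂ {x | x ∈ ([] : List (Fin n → ℂ))} := by
      simpa using hA b List.mem_cons_self
    rw [hilbPoly, if_neg hb, List.length_cons, coeff_add, coeff_succ_X_zero_mul]
    have := ih fun x hx => hA x (List.mem_cons_of_mem _ hx)
    omega

lemma totalDegree_hilbPoly {A : List (Fin n → ℂ)} (hA : ∀ b ∈ A, b ≠ 0) :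
    (hilbPoly A []).totalDegree = A.length := by
  refine le_antisymm (by simpa using totalDegree_hilbPoly_le A []) ?_
  have := le_totalDegree (mem_support_iff.2 (coeff_hilbPoly_ne_zero hA))
  rw [Finsupp.sum_fintype _ _ (fun _ => rfl)] at this
  simpa [Fin.sum_univ_two, qtExp_apply_zero, qtExp_apply_one] using this

lemma toRatQT_add (p q : MvPolynomial (Fin 2) ℕ) :
    toRatQT (p + q) = toRatQT p + toRatQT q := by simp [toRatQT]

lemma toRatQT_mul (p q : MvPolynomial (Fin 2) ℕ) :
    toRatQT (p * q) = toRatQT p * toRatQT q := by simp [toRatQT]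

lemma toRatQT_pow (p : MvPolynomial (Fin 2) ℕ) (k : ℕ) :
    toRatQT (p ^ k) = toRatQT p ^ k := by simp [toRatQT]

lemma toRatQT_zero : toRatQT 0 = 0 := by simp [toRatQT]

lemma qVar_ne_zero : qVar ≠ 0 := by
  simp [qVar, toRatQT]

lemma tVar_ne_zero : tVar ≠ 0 := by
  simp [tVar, toRatQT]

section Rank

variable {ι : Type*} (a : ι → Fin n → ℂ)

/-- The rank of the vectors in the list `W` together with those indexed by `S`. -/
def rkUnion (W : List (Fin n → ℂ)) (S : Finset ι) : ℕ :=
  Module.finrank ℂ (Submodule.span ℂ ({x | x ∈ W} ∪ a '' (S : Set ι)))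

lemma rkUnion_cons_of_mem {W : List (Fin n → ℂ)} {b : Fin n → ℂ}
    (hb : b ∈ Submodule.span ℂ {x | x ∈ W}) (S : Finset ι) :
    rkUnion a (b :: W) S = rkUnion a W S := by
  rw [rkUnion, rkUnion]
  have : {x | x ∈ b :: W} ∪ a '' (S : Set ι) = insert b ({x | x ∈ W} ∪ a '' (S : Set ι)) := by
    ext x
    simp only [Set.mem_union, Set.mem_insert_iff, List.mem_cons, Set.mem_ofPred_eq]
    tauto
  rw [this, Submodule.span_insert_eq_span (Submodule.span_mono Set.subset_union_left hb)]

variable [DecidableEq ι]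

lemma rkUnion_insert (W : List (Fin n → ℂ)) (S : Finset ι) (i : ι) :
    rkUnion a W (insert i S) = rkUnion a (a i :: W) S := by
  rw [rkUnion, rkUnion]
  have : {x | x ∈ W} ∪ a '' ((insert i S : Finset ι) : Set ι) =
      {x | x ∈ a i :: W} ∪ a '' (S : Set ι) := by
    ext x
    simp only [Finset.coe_insert, Set.image_insert_eq, Set.mem_union, Set.mem_insert_iff,
      List.mem_cons, Set.mem_ofPred_eq]
    tauto
  rw [this]

/-- The top-degree summand as a signed sum over subsets. -/
theorem toRatQT_hilbTop (l : List ι) (hl : l.Nodup) {W : List (Fin n → ℂ)} (hW : Indep W) :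
    toRatQT (hilbTop (l.map a) W) = ∑ S ∈ l.toFinset.powerset,
      (-1) ^ S.card * ((-1) ^ W.length * qVar ^ (l.length + W.length) *
        (-(tVar / qVar)) ^ rkUnion a W S) := by
  induction l generalizing W with
  | nil =>
    have h : rkUnion a W ∅ = W.length := by
      rw [rkUnion, Finset.coe_empty, Set.image_empty, Set.union_empty, finrank_span_of_indep hW]
    simp only [List.map_nil, hilbTop_nil, toRatQT_pow, List.toFinset_nil, Finset.powerset_empty,
      Finset.sum_singleton, Finset.card_empty, h, List.length_nil, zero_add, pow_zero, one_mul]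
    rw [← mul_pow, ← mul_pow]
    congr 1
    have := qVar_ne_zero
    change tVar = _
    field_simp
  | cons i l ih =>
    obtain ⟨hi, hl⟩ := List.nodup_cons.1 hl
    have hi' : i ∉ l.toFinset := by simpa using hi
    rw [List.toFinset_cons, Finset.sum_powerset_insert hi', List.map_cons]
    have hcard : ∀ S ∈ l.toFinset.powerset, (insert i S).card = S.card + 1 := fun S hS =>
      Finset.card_insert_of_notMem fun h => hi' (Finset.mem_powerset.1 hS h)
    by_cases hb : a i ∈ Submodule.span ℂ {x | x ∈ W}
    -- For a vector in the span of W, the subsets S and S with i added have equal rank and opposite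
    -- sign, so they cancel in pairs.
    · rw [hilbTop_cons_of_mem hb, toRatQT_zero, ← Finset.sum_add_distrib, eq_comm]
      refine Finset.sum_eq_zero fun S hS => ?_
      rw [hcard S hS, rkUnion_insert, rkUnion_cons_of_mem a hb, pow_succ]
      ring
    · rw [hilbTop_cons_of_notMem hb, toRatQT_add, toRatQT_mul, ih hl hW,
        ih hl (W := a i :: W) ⟨hb, hW⟩, Finset.mul_sum]
      -- Subsets without i give the deletion term. Those with i give the contraction term, their
      -- extra sign matching the one from the longer list.
      congr 1
      · refine Finset.sum_congr rfl fun S _ => ?_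
        change qVar * _ = _
        rw [List.length_cons, add_right_comm, pow_succ]
        ring
      · refine Finset.sum_congr rfl fun S hS => ?_
        rw [hcard S hS, rkUnion_insert, List.length_cons, List.length_cons]
        ring

end Rank

lemma rk_le_rank (A : Multiarrangement n m) (S : Finset (Fin m)) : A.rk S ≤ A.rank := by
  rw [Multiarrangement.rank, Multiarrangement.rk, Multiarrangement.rk]
  exact Submodule.finrank_mono (Submodule.span_mono (Set.image_mono (by simp)))

lemma rank_le (A : Multiarrangement n m) : A.rank ≤ m := by
  classical
  rw [Multiarrangement.rank, Multiarrangement.rk]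
  have := finrank_span_finset_le_card (R := ℂ) (Finset.univ.image A.normal)
  rw [Finset.coe_image] at this
  exact this.trans (Finset.card_image_le.trans (by simp))

theorem toRatQT_hilbTop_normals (A : Multiarrangement n m) :
    toRatQT (hilbTop A.normals []) = (-1) ^ A.rank * qVar ^ (m - A.rank) * tVar ^ A.rank *
      Polynomial.aeval (-(qVar / tVar)) A.charPoly := by
  have hq := qVar_ne_zero
  have ht := tVar_ne_zero
  have h := toRatQT_hilbTop A.normal (List.finRange m) (List.nodup_finRange m) indep_nil
  rw [← List.ofFn_eq_map] at h
  rw [Multiarrangement.normals, h, Multiarrangement.charPoly, map_sum, Finset.mul_sum]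
  have huniv : (List.finRange m).toFinset.powerset = Finset.univ := by ext; simp
  rw [huniv]
  refine Finset.sum_congr rfl fun S _ => ?_
  have hrk : rkUnion A.normal [] S = A.rk S := by
    have : {x : Fin n → ℂ | x ∈ []} ∪ A.normal '' (S : Set (Fin m)) =
        A.normal '' (S : Set (Fin m)) := by ext; simp
    rw [rkUnion, this, Multiarrangement.rk]
  have h1 := rk_le_rank A S
  -- As -t/q and -q/t are inverse, an exponent rk S on the first becomes r on the first and r - rk S
  -- on the second, the exponent in χ.
  have h2 : (-(tVar / qVar)) ^ A.rk S =
      (-(tVar / qVar)) ^ A.rank * (-(qVar / tVar)) ^ (A.rank - A.rk S) := by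
    conv_rhs => rw [← Nat.add_sub_cancel' h1, pow_add, mul_assoc, Nat.add_sub_cancel_left]
    rw [← mul_pow]
    have : -(tVar / qVar) * -(qVar / tVar) = 1 := by field_simp
    rw [this, one_pow, mul_one]
  have h3 : qVar ^ m * (-(tVar / qVar)) ^ A.rank =
      (-1) ^ A.rank * qVar ^ (m - A.rank) * tVar ^ A.rank := by
    have hm : qVar ^ m = qVar ^ (m - A.rank) * qVar ^ A.rank := by
      rw [← pow_add, Nat.sub_add_cancel (rank_le A)]
    rw [hm, mul_assoc, ← mul_pow]
    have : qVar * -(tVar / qVar) = -1 * tVar := by field_simp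
    rw [this, mul_pow]
    ring
  rw [hrk, h2, ← h3]
  simp
  ring

lemma coeff_aeval_X_zero (P : MvPolynomial (Fin 2) ℕ) (i : ℕ) :
    PowerSeries.coeff i (MvPolynomial.aeval ![(PowerSeries.X : PowerSeries ℕ), 0] P) =
      coeff (qtExp i 0) P := by
  induction P using MvPolynomial.induction_on' with
  | monomial e c =>
    rw [aeval_monomial, coeff_monomial, Finsupp.prod_fintype _ _ (fun _ => pow_zero _),
      Fin.prod_univ_two]
    have he : e = qtExp i 0 ↔ e 0 = i ∧ e 1 = 0 := by
      constructor
      · rintro rfl; exact ⟨qtExp_apply_zero i 0, qtExp_apply_one i 0⟩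
      · rintro ⟨h0, h1⟩; rw [eq_qtExp e, h0, h1]
    simp only [he, Matrix.cons_val_zero, Matrix.cons_val_one]
    have hc : (c : PowerSeries ℕ) = PowerSeries.C c := (map_natCast PowerSeries.C c).symm
    by_cases h1 : e 1 = 0
    · simp only [h1, and_true, pow_zero, mul_one, eq_natCast]
      rw [hc, PowerSeries.coeff_C_mul, PowerSeries.coeff_X_pow]
      simp [eq_comm]
    · simp [h1]
  | add p q hp hq => rw [map_add, map_add, coeff_add, hp, hq]

end Superspace

/-! ### Assembly -/

theorem corollary4p4 (n m : ℕ) (A : Multiarrangement n m) :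
    ∃ P : MvPolynomial (Fin 2) ℕ,
      (P : MvPowerSeries (Fin 2) ℕ) = A.hilbE ∧
      MvPolynomial.aeval ![(PowerSeries.X : PowerSeries ℕ), 0] P = hilb (A.powerIdeal 1) ∧
      (A.rank = n → tCoeff A.rank A.hilbE = hilb (A.powerIdeal 0)) ∧
      tCoeff A.rank A.hilbE = hilb A.essCentralIdeal ∧
      toRatQT (topPart P) =
        (-1) ^ A.rank * qVar ^ (m - A.rank) * tVar ^ A.rank *
          Polynomial.aeval (-(qVar / tVar)) A.charPoly := by
  have hess : tCoeff A.rank A.hilbE = hilb A.essCentralIdeal := by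
    obtain ⟨W, hW, hWA⟩ := Superspace.exists_indep A.normals
    have hr : A.rank = W.length := by
      rw [← Superspace.finrank_span_of_indep hW, hWA, Superspace.span_normals]
      rfl
    ext i
    rw [tCoeff, hilb, PowerSeries.coeff_mk, PowerSeries.coeff_mk,
      ← Superspace.quotientPieceDim_bidegree_length A hW hWA, hr]
    change quotientPieceDim A.superIdeal (Superspace.bidegree n
      (Superspace.qtExp i W.length 0) (Superspace.qtExp i W.length 1)) = _
    rw [Superspace.qtExp_apply_zero, Superspace.qtExp_apply_one]
  refine ⟨Superspace.hilbPoly A.normals [], ?_, ?_, fun h => ?_, hess, ?_⟩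
  · ext e
    rw [MvPolynomial.coeff_coe]
    change _ = quotientPieceDim A.superIdeal (Superspace.bidegree n (e 0) (e 1))
    rw [Superspace.quotientPieceDim_superIdeal, ← Superspace.eq_qtExp]
  · ext i
    rw [Superspace.coeff_aeval_X_zero, hilb, PowerSeries.coeff_mk,
      ← Superspace.quotientPieceDim_superIdeal, Superspace.quotientPieceDim_bidegree_zero]
  · rw [hess, Superspace.powerIdeal_zero_eq_essCentralIdeal A h]
  · rw [← Superspace.toRatQT_hilbTop_normals, topPart, Superspace.hilbTop,
      Superspace.totalDegree_hilbPoly, List.length_nil, add_zero]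
    intro b hb
    obtain ⟨i, rfl⟩ := (List.mem_ofFn' _ _).1 hb
    exact A.normal_ne_zero i

end
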